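/- Let $n\ge 3$ and $\ell\ge 2$ be integers, let $\zeta\in\mathbb{C}$ be a primitive $\ell$-th root of unity, and let $t=(t_1,\dots,t_n)\in\mathbb{C}^n$. All subscripts are taken modulo $n$. Let $V=\mathbb{C}^n$ with standard basis $x_1,\dots,x_n$, and let $G\subset SL_n(\mathbb{C})$ be the group of all diagonal matrices $g$ with $g^\ell=1$. For $i=1,\dots,n$ let $g_i\in G$ be given by $g_i(x_i)=\zeta x_i$, $g_i(x_{i+1})=\zeta^{-1}x_{i+1}$ and $g_i(x_j)=x_j$ for $j\neq i,i+1$; then $G\cong(\mathbb{Z}/\ell\mathbb{Z})^{n-1}$ is freely generated, as a $\mathbb{Z}/\ell\mathbb{Z}$-module, by $g_1,\dots,g_{n-1}$. Let $\alpha:G\times G\to\mathbb{C}^\times$ be the $2$-cocycle $$\alpha\big(g_1^{i_1}\cdots g_{n-1}^{i_{n-1}},\,g_1^{j_1}\cdots g_{n-1}^{j_{n-1}}\big)=\zeta^{-i_1j_2-i_2j_3-\cdots-i_{n-2}j_{n-1}}.$$ Let $TV\#_\alpha G$ be the crossed product of the tensor algebra $TV$ with $G$, i.e. the vector space $TV\otimes\mathbb{C}G$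 with product $(r\otimes g)(s\otimes h)=\alpha(g,h)\,r\,(g\cdot s)\otimes gh$; the product of $g,h\in G$ in this algebra is written $g*h=\alpha(g,h)\,gh$. Let $\mathsf{H}$ be the quotient of $TV\#_\alpha G$ by the relations $$x_ix_{i+1}-x_{i+1}x_i=t_ig_i,\qquad x_ix_j-x_jx_i=0$$ for all $i,j\in\{1,\dots,n\}$ with $|i-j|\notin\{1,n-1\}$. Let $J$ be the set of all subsets $\{i_1<\dots<i_k\}$ of $\{1,\dots,n\}$ ($k\ge 0$) with $|i_r-i_s|\notin\{1,n-1\}$ for all $r,s$. Put $\delta=(1,\dots,1)\in\mathbb{Z}^n$, let $\varepsilon_i\in\mathbb{Z}^n$ be the vector with entries $1$ in positions $i$ and $i+1$ and $0$ elsewhere, and write $x^p=x_1^{p_1}\cdots x_n^{p_n}$. Put $\tau_i=\frac{t_i}{\zeta-1}$ for $1\le i\le n-1$ and $\tau_n=\frac{\zeta t_n}{\zeta-1}$, and $$w=\sum_{\{i_1<\dots<i_k\}\in J}\tau_{i_1}\cdots\tau_{i_k}\,x^{\delta-\varepsilon_{i_1}-\cdots-\varepsilon_{i_k}}\,g_{i_1}*\cdots*g_{i_k}\in\mathsf{H}.$$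 Then the center of $\mathsf{H}$ is generated, as a $\mathbb{C}$-algebra, by $x_1^\ell,\dots,x_n^\ell$ and $w$. -/

import Mathlib

noncomputable section

namespace HomocyclicHecke

/-! ### Crossed products twisted by a 2-cocycle -/

/-- A normalized `ℂˣ`-valued 2-cocycle of `G` (trivial action on `ℂˣ`). -/
structure TwoCocycle (G : Type*) [Group G] where
  /-- the underlying function -/
  toFun : G → G → ℂˣ
  cocycle : ∀ f g h, toFun f g * toFun (f * g) h = toFun g h * toFun f (g * h)
  one_left : ∀ g, toFun 1 g = 1
  one_right : ∀ g, toFun g 1 = 1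

/-- The underlying space `E ⊗ ℂG` of the crossed product `E #_α G`, realized as the finitely
supported functions `G → E`; `Finsupp.single g r` is `r ⊗ g`. -/
def CrossedProduct {G E : Type*} [Group G] [Ring E] [Algebra ℂ E]
    (_ρ : G →* (E ≃ₐ[ℂ] E)) (_α : TwoCocycle G) : Type _ := G →₀ E

namespace CrossedProduct

section

variable {G E : Type*} [Group G] [Ring E] [Algebra ℂ E]
  (ρ : G →* (E ≃ₐ[ℂ] E)) (α : TwoCocycle G)

instance : AddCommGroup (CrossedProduct ρ α) := inferInstanceAs (AddCommGroup (G →₀ E))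

instance : Module ℂ (CrossedProduct ρ α) := inferInstanceAs (Module ℂ (G →₀ E))

/-- The element `r ⊗ g`. -/
def tmul (r : E) (g : G) : CrossedProduct ρ α := Finsupp.single g r

/-- The product on `G →₀ E`: `(r ⊗ g) (s ⊗ h) = α(g, h) r (g · s) ⊗ g h`, extended
biadditively. -/
def mulFun (a b : G →₀ E) : G →₀ E :=
  a.sum fun g r => b.sum fun h s =>
    Finsupp.single (g * h) ((α.toFun g h : ℂ) • (r * ρ g s))

theorem mulFun_single (r s : E) (g h : G) :
    mulFun ρ α (Finsupp.single g r) (Finsupp.single h s)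
      = Finsupp.single (g * h) ((α.toFun g h : ℂ) • (r * ρ g s)) := by
  rw [mulFun, Finsupp.sum_single_index, Finsupp.sum_single_index] <;> simp

theorem mulFun_add (a b c : G →₀ E) : mulFun ρ α a (b + c) = mulFun ρ α a b + mulFun ρ α a c := by
  simp only [mulFun]
  rw [← Finsupp.sum_add]
  refine Finsupp.sum_congr fun g _ => ?_
  refine Finsupp.sum_add_index' (fun h => ?_) (fun h s s' => ?_)
  · simp
  · simp [mul_add]

theorem add_mulFun (a b c : G →₀ E) : mulFun ρ α (a + b) c = mulFun ρ α a c + mulFun ρ α b c := by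
  simp only [mulFun]
  refine Finsupp.sum_add_index' (fun h => ?_) (fun h s s' => ?_)
  · simp
  · rw [← Finsupp.sum_add]
    refine Finsupp.sum_congr fun g _ => ?_
    simp [add_mul]

theorem zero_mulFun (a : G →₀ E) : mulFun ρ α 0 a = 0 := by
  simp [mulFun]

theorem mulFun_zero (a : G →₀ E) : mulFun ρ α a 0 = 0 := by
  simp [mulFun]

instance : Mul (CrossedProduct ρ α) := ⟨mulFun ρ α⟩

instance : One (CrossedProduct ρ α) := ⟨tmul ρ α 1 1⟩

variable {ρ α}

theorem one_def : (1 : CrossedProduct ρ α) = tmul ρ α 1 1 := rfl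

theorem smul_tmul (c : ℂ) (r : E) (g : G) : c • tmul ρ α r g = tmul ρ α (c • r) g :=
  Finsupp.smul_single c g r

theorem tmul_mul_tmul (r s : E) (g h : G) :
    tmul ρ α r g * tmul ρ α s h = tmul ρ α ((α.toFun g h : ℂ) • (r * ρ g s)) (g * h) :=
  mulFun_single ρ α r s g h

theorem induction {p : CrossedProduct ρ α → Prop} (a : CrossedProduct ρ α) (zero : p 0)
    (add : ∀ a b, p a → p b → p (a + b)) (tmul : ∀ r g, p (tmul ρ α r g)) : p a :=
  Finsupp.induction_linear (motive := p) a zero add fun g r => tmul r g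

instance : NonUnitalNonAssocRing (CrossedProduct ρ α) :=
  { (inferInstance : AddCommGroup (CrossedProduct ρ α)),
    (inferInstance : Mul (CrossedProduct ρ α)) with
    left_distrib := mulFun_add ρ α
    right_distrib := add_mulFun ρ α
    zero_mul := fun a => zero_mulFun ρ α a
    mul_zero := fun a => mulFun_zero ρ α a }

theorem assoc (a b c : CrossedProduct ρ α) : a * b * c = a * (b * c) := by
  induction a using CrossedProduct.induction with
  | zero => simp
  | add a a' h h' => simp only [add_mul, h, h']
  | tmul r f =>
  induction b using CrossedProduct.induction with
  | zero => simp
  | add a a' h h' => simp only [add_mul, mul_add, h, h']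
  | tmul s g =>
  induction c using CrossedProduct.induction with
  | zero => simp
  | add a a' h h' => simp only [mul_add, h, h']
  | tmul u h =>
  have key : (α.toFun (f * g) h : ℂ) * (α.toFun f g : ℂ)
      = (α.toFun f (g * h) : ℂ) * (α.toFun g h : ℂ) := by
    have := congrArg (Units.val) (α.cocycle f g h)
    simp only [Units.val_mul] at this
    rw [mul_comm, this, mul_comm]
  simp only [tmul_mul_tmul, map_smul, map_mul, smul_mul_assoc, mul_smul_comm, smul_smul, key,
    mul_assoc, AlgEquiv.mul_apply]

theorem one_mul' (a : CrossedProduct ρ α) : 1 * a = a := by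
  induction a using CrossedProduct.induction with
  | zero => simp
  | add a a' h h' => simp only [mul_add, h, h']
  | tmul r f => simp [one_def, tmul_mul_tmul, α.one_left]

theorem mul_one' (a : CrossedProduct ρ α) : a * 1 = a := by
  induction a using CrossedProduct.induction with
  | zero => simp
  | add a a' h h' => simp only [add_mul, h, h']
  | tmul r f => simp [one_def, tmul_mul_tmul, α.one_right]

instance : Ring (CrossedProduct ρ α) :=
  { (inferInstance : NonUnitalNonAssocRing (CrossedProduct ρ α)),
    (inferInstance : One (CrossedProduct ρ α)) with
    mul_assoc := assoc
    one_mul := one_mul'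
    mul_one := mul_one' }

theorem smul_mul' (c : ℂ) (a b : CrossedProduct ρ α) : (c • a) * b = c • (a * b) := by
  induction a using CrossedProduct.induction with
  | zero => simp
  | add a a' h h' => simp only [add_mul, smul_add, h, h']
  | tmul r f =>
  induction b using CrossedProduct.induction with
  | zero => simp
  | add a a' h h' => simp only [mul_add, smul_add, h, h']
  | tmul s g => simp only [smul_tmul, tmul_mul_tmul, smul_mul_assoc, smul_smul, mul_comm]

theorem mul_smul' (c : ℂ) (a b : CrossedProduct ρ α) : a * (c • b) = c • (a * b) := by
  induction a using CrossedProduct.induction with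
  | zero => simp
  | add a a' h h' => simp only [add_mul, smul_add, h, h']
  | tmul r f =>
  induction b using CrossedProduct.induction with
  | zero => simp
  | add a a' h h' => simp only [mul_add, smul_add, h, h']
  | tmul s g =>
    simp only [smul_tmul, tmul_mul_tmul, map_smul, mul_smul_comm, smul_smul, mul_comm]

instance : Algebra ℂ (CrossedProduct ρ α) :=
  Algebra.ofModule smul_mul' mul_smul'

end

end CrossedProduct

/-! ### The homocyclic group -/

/-- The group of diagonal matrices `g ∈ SL_n(ℂ)` with `g ^ ℓ = 1`. -/
def diagGroup (n ℓ : ℕ) : Subgroup (Matrix.SpecialLinearGroup (Fin n) ℂ) where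
  carrier := {g | (g : Matrix (Fin n) (Fin n) ℂ).IsDiag ∧ g ^ ℓ = 1}
  one_mem' := ⟨Matrix.isDiag_one, one_pow ℓ⟩
  mul_mem' := by
    rintro a b ⟨ha, ha'⟩ ⟨hb, hb'⟩
    have hcomm : Commute a b := by
      apply Subtype.ext
      rw [Matrix.SpecialLinearGroup.coe_mul, Matrix.SpecialLinearGroup.coe_mul,
        ← ha.diagonal_diag, ← hb.diagonal_diag, Matrix.diagonal_mul_diagonal,
        Matrix.diagonal_mul_diagonal]
      simp only [mul_comm]
    refine ⟨?_, by rw [hcomm.mul_pow, ha', hb', one_mul]⟩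
    rw [Matrix.SpecialLinearGroup.coe_mul, ← ha.diagonal_diag, ← hb.diagonal_diag,
      Matrix.diagonal_mul_diagonal]
    exact Matrix.isDiag_diagonal _
  inv_mem' := by
    rintro a ⟨ha, ha'⟩
    refine ⟨?_, by rw [inv_pow, ha', inv_one]⟩
    rw [Matrix.SpecialLinearGroup.coe_inv, ← ha.diagonal_diag, Matrix.adjugate_diagonal]
    exact Matrix.isDiag_diagonal _

theorem coe_eq_diagonal {n ℓ : ℕ} (g : diagGroup n ℓ) :
    (g.1 : Matrix (Fin n) (Fin n) ℂ) = Matrix.diagonal fun j => g.1.1 j j :=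
  (g.2.1.diagonal_diag).symm

theorem mul_diag {n ℓ : ℕ} (g h : diagGroup n ℓ) (j : Fin n) :
    (g * h).1.1 j j = g.1.1 j j * h.1.1 j j := by
  have : (g * h).1.1 = g.1.1 * h.1.1 := rfl
  rw [this, coe_eq_diagonal g, coe_eq_diagonal h, Matrix.diagonal_mul_diagonal]
  simp

theorem ext_diag {n ℓ : ℕ} {g h : diagGroup n ℓ} (H : ∀ j, g.1.1 j j = h.1.1 j j) : g = h := by
  apply Subtype.ext
  apply Subtype.ext
  rw [coe_eq_diagonal g, coe_eq_diagonal h]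
  simp only [H]

instance (n ℓ : ℕ) : CommGroup (diagGroup n ℓ) :=
  { (inferInstance : Group (diagGroup n ℓ)) with
    mul_comm := fun g h => ext_diag fun j => by rw [mul_diag, mul_diag, mul_comm] }

/-- The diagonal entries of the generator `g_i`: `ζ` at `i`, `ζ⁻¹` at `i + 1` (cyclically),
and `1` elsewhere. -/
def genEntry {n : ℕ} [NeZero n] (ζ : ℂ) (i j : Fin n) : ℂ :=
  if j = i then ζ else if j = i + 1 then ζ⁻¹ else 1

theorem succ_ne {n : ℕ} [NeZero n] (hn : 3 ≤ n) (i : Fin n) : i + 1 ≠ i := by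
  intro h
  have h1 : (1 : Fin n) = 0 := by simpa using h
  have := congrArg Fin.val h1
  rw [Fin.val_one', Fin.val_zero, Nat.mod_eq_of_lt (by omega)] at this
  omega

theorem genEntry_eq {n : ℕ} [NeZero n] (hn : 3 ≤ n) (ζ : ℂ) (i j : Fin n) :
    genEntry ζ i j = (if j = i then ζ else 1) * (if j = i + 1 then ζ⁻¹ else 1) := by
  unfold genEntry
  by_cases h : j = i
  · subst h; simp [(succ_ne hn j).symm]
  · simp [h]

/-- The generator `g_i` as an element of `SL_n(ℂ)`. -/
def genSL {n : ℕ} [NeZero n] (hn : 3 ≤ n) {ζ : ℂ} (hζ0 : ζ ≠ 0) (i : Fin n) :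
    Matrix.SpecialLinearGroup (Fin n) ℂ :=
  ⟨Matrix.diagonal (genEntry ζ i), by
    rw [Matrix.det_diagonal]
    simp only [genEntry_eq hn, Finset.prod_mul_distrib, Finset.prod_ite_eq', Finset.mem_univ,
      if_true]
    exact mul_inv_cancel₀ hζ0⟩

/-- The generator `g_i` of the group. -/
def gen {n ℓ : ℕ} [NeZero n] (hn : 3 ≤ n) (hℓ : 2 ≤ ℓ) {ζ : ℂ} (hζ : IsPrimitiveRoot ζ ℓ)
    (i : Fin n) : diagGroup n ℓ :=
  ⟨genSL hn (hζ.ne_zero (by omega)) i, by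
    refine ⟨Matrix.isDiag_diagonal _, ?_⟩
    apply Subtype.ext
    rw [Matrix.SpecialLinearGroup.coe_pow, Matrix.SpecialLinearGroup.coe_one]
    change Matrix.diagonal (genEntry ζ i) ^ ℓ = 1
    rw [Matrix.diagonal_pow, ← Matrix.diagonal_one]
    congr 1
    funext j
    simp only [Pi.pow_apply, genEntry]
    split_ifs <;> simp [hζ.pow_eq_one]⟩

section Cocycle

variable {n ℓ : ℕ}

/-- The product of the first `k + 1` diagonal entries. -/
def partialProd (k : ℕ) : diagGroup n ℓ →* ℂ where
  toFun g := ∏ j : Fin n with j.val ≤ k, g.1.1 j j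
  map_one' := by
    refine Finset.prod_eq_one fun j _ => ?_
    change (1 : Matrix (Fin n) (Fin n) ℂ) j j = 1
    simp
  map_mul' g h := by simp only [mul_diag, Finset.prod_mul_distrib]

theorem partialProd_zpow (k : ℕ) (g : diagGroup n ℓ) (z : ℤ) :
    partialProd k (g ^ z) = partialProd k g ^ z :=
  ((partialProd k).toHomUnits.map_zpow g z ▸ Units.val_zpow_eq_zpow_val _ _ :
    ((partialProd k).toHomUnits (g ^ z) : ℂ) = _)

theorem ext_partialProd {g h : diagGroup n ℓ}
    (H : ∀ k < n - 1, partialProd k g = partialProd k h) : g = h := by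
  have H' : ∀ k < n, partialProd k g = partialProd k h := by
    intro k hk
    rcases Nat.lt_or_ge k (n - 1) with h1 | h1
    · exact H k h1
    · have aux : ∀ f : diagGroup n ℓ, partialProd k f = 1 := by
        intro f
        have hf : (f.1 : Matrix (Fin n) (Fin n) ℂ).det = 1 := f.1.2
        rw [coe_eq_diagonal, Matrix.det_diagonal] at hf
        rw [← hf]
        change ∏ j : Fin n with j.val ≤ k, f.1.1 j j = _
        rw [Finset.filter_true_of_mem]
        intro j _
        have := j.2
        omega
      rw [aux, aux]
  have step : ∀ (f : diagGroup n ℓ) (k : ℕ) (hk : k + 1 < n),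
      partialProd (k + 1) f = partialProd k f * f.1.1 ⟨k + 1, hk⟩ ⟨k + 1, hk⟩ := by
    intro f k hk
    change ∏ j : Fin n with j.val ≤ k + 1, f.1.1 j j
      = (∏ j : Fin n with j.val ≤ k, f.1.1 j j) * _
    have : (Finset.univ.filter fun j : Fin n => j.val ≤ k + 1)
        = insert ⟨k + 1, hk⟩ (Finset.univ.filter fun j : Fin n => j.val ≤ k) := by
      ext j
      simp only [Finset.mem_filter, Finset.mem_univ, true_and, Finset.mem_insert, Fin.ext_iff]
      omega
    rw [this, Finset.prod_insert (by simp), mul_comm]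
  have zero : ∀ (f : diagGroup n ℓ) (hk : 0 < n), partialProd 0 f = f.1.1 ⟨0, hk⟩ ⟨0, hk⟩ := by
    intro f hk
    change ∏ j : Fin n with j.val ≤ 0, f.1.1 j j = _
    have : (Finset.univ.filter fun j : Fin n => j.val ≤ 0) = {⟨0, hk⟩} := by
      ext j
      simp only [Finset.mem_filter, Finset.mem_univ, true_and, Finset.mem_singleton, Fin.ext_iff]
      omega
    rw [this, Finset.prod_singleton]
  refine ext_diag fun j => ?_
  obtain ⟨j, hj⟩ := j
  cases j with
  | zero => rw [← zero, ← zero, H' 0 hj]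
  | succ k =>
    have h1 := H' (k + 1) hj
    rw [step g k hj, step h k hj, H' k (by omega)] at h1
    refine mul_left_cancel₀ ?_ h1
    exact ((partialProd k).toHomUnits h).ne_zero

variable [NeZero n] (hn : 3 ≤ n) (hℓ : 2 ≤ ℓ) {ζ : ℂ} (hζ : IsPrimitiveRoot ζ ℓ)

/-- The element `g_1^{a_1} ⋯ g_{n-1}^{a_{n-1}}` (all indices are shifted by one here). -/
def word (a : ℕ → ℤ) : diagGroup n ℓ :=
  ∏ k ∈ Finset.range (n - 1), gen hn hℓ hζ (Fin.ofNat n k) ^ a k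

theorem partialProd_gen {k m : ℕ} (hm : m < n - 1) :
    partialProd k (gen hn hℓ hζ (Fin.ofNat n m)) = if m = k then ζ else 1 := by
  have hζ0 : ζ ≠ 0 := hζ.ne_zero (by omega)
  have h1 : (Fin.ofNat n m).val = m := by simp [Fin.ofNat, Nat.mod_eq_of_lt (show m < n by omega)]
  have h2 : (Fin.ofNat n m + 1).val = m + 1 := by
    rw [Fin.val_add, h1, Fin.val_one', Nat.mod_eq_of_lt (show 1 < n by omega),
      Nat.mod_eq_of_lt (by omega)]
  change ∏ j : Fin n with j.val ≤ k, Matrix.diagonal (genEntry ζ (Fin.ofNat n m)) j j = _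
  simp only [Matrix.diagonal_apply_eq, genEntry_eq hn, Finset.prod_mul_distrib,
    Finset.prod_ite_eq', Finset.mem_filter, Finset.mem_univ, true_and, h1, h2]
  rcases lt_trichotomy m k with h | h | h
  · rw [if_pos h.le, if_pos (by omega), if_neg h.ne, mul_inv_cancel₀ hζ0]
  · rw [if_pos h.le, if_neg (by omega), if_pos h, mul_one]
  · rw [if_neg (by omega), if_neg (by omega), if_neg (by omega), mul_one]

theorem partialProd_word {k : ℕ} (hk : k < n - 1) (a : ℕ → ℤ) :
    partialProd k (word hn hℓ hζ a) = ζ ^ a k := by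
  rw [word, map_prod, Finset.prod_eq_single k]
  · rw [partialProd_zpow, partialProd_gen hn hℓ hζ hk, if_pos rfl]
  · intro m hm hmk
    rw [partialProd_zpow, partialProd_gen hn hℓ hζ (Finset.mem_range.1 hm), if_neg hmk, one_zpow]
  · intro h
    exact absurd (Finset.mem_range.2 hk) h

theorem word_add (a b : ℕ → ℤ) :
    word hn hℓ hζ (a + b) = word hn hℓ hζ a * word hn hℓ hζ b := by
  simp only [word, Pi.add_apply, zpow_add, Finset.prod_mul_distrib]

theorem word_zero : word hn hℓ hζ 0 = 1 := by simp [word]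

theorem exists_word (g : diagGroup n ℓ) : ∃ a : ℕ → ℤ, g = word hn hℓ hζ a := by
  have : NeZero ℓ := ⟨by omega⟩
  have h : ∀ k, ∃ z : ℤ, ζ ^ z = partialProd k g := by
    intro k
    have hg : g ^ ℓ = 1 := Subtype.ext g.2.2
    obtain ⟨i, -, hi⟩ := hζ.eq_pow_of_pow_eq_one
      (show partialProd k g ^ ℓ = 1 by rw [← map_pow, hg, map_one])
    exact ⟨i, by rw [zpow_natCast, hi]⟩
  choose a ha using h
  exact ⟨a, ext_partialProd fun k hk => by rw [partialProd_word hn hℓ hζ hk, ha]⟩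

/-- Exponents `a` with `g = g_1^{a_1} ⋯ g_{n-1}^{a_{n-1}}`; they are unique modulo `ℓ`. -/
def expo (g : diagGroup n ℓ) : ℕ → ℤ := (exists_word hn hℓ hζ g).choose

theorem word_expo (g : diagGroup n ℓ) : word hn hℓ hζ (expo hn hℓ hζ g) = g :=
  (exists_word hn hℓ hζ g).choose_spec.symm

/-- The value `ζ ^ (- i_1 j_2 - i_2 j_3 - ⋯ - i_{n-2} j_{n-1})` at two elements with exponents
`i` and `j`. -/
def alphaFun (g h : diagGroup n ℓ) : ℂˣ :=
  Units.mk0 ζ (hζ.ne_zero (by omega)) ^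
    (-∑ k ∈ Finset.range (n - 2), expo hn hℓ hζ g k * expo hn hℓ hζ h (k + 1))

/-- The cocycle does not depend on the choice of the exponents. -/
theorem alphaFun_word (i j : ℕ → ℤ) :
    (alphaFun hn hℓ hζ (word hn hℓ hζ i) (word hn hℓ hζ j) : ℂ)
      = ζ ^ (-∑ k ∈ Finset.range (n - 2), i k * j (k + 1)) := by
  have hζ0 : ζ ≠ 0 := hζ.ne_zero (by omega)
  have key : ∀ (a : ℕ → ℤ) (k : ℕ), k < n - 1 →
      ζ ^ expo hn hℓ hζ (word hn hℓ hζ a) k = ζ ^ a k := by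
    intro a k hk
    rw [← partialProd_word hn hℓ hζ hk, word_expo, partialProd_word hn hℓ hζ hk]
  rw [alphaFun, Units.val_zpow_eq_zpow_val, Units.val_mk0, zpow_neg, zpow_neg]
  congr 1
  have hsum : ∀ f : ℕ → ℤ, ζ ^ (∑ k ∈ Finset.range (n - 2), f k)
      = ∏ k ∈ Finset.range (n - 2), ζ ^ f k := by
    intro f
    induction n - 2 with
    | zero => simp
    | succ m ih => rw [Finset.sum_range_succ, Finset.prod_range_succ, zpow_add₀ hζ0, ih]
  rw [hsum, hsum]
  refine Finset.prod_congr rfl fun k hk => ?_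
  have hk' := Finset.mem_range.1 hk
  rw [zpow_mul, key i k (by omega), ← zpow_mul, mul_comm, zpow_mul, key j (k + 1) (by omega),
    ← zpow_mul, mul_comm]

theorem alphaFun_mul_left (f g h : diagGroup n ℓ) :
    alphaFun hn hℓ hζ (f * g) h = alphaFun hn hℓ hζ f h * alphaFun hn hℓ hζ g h := by
  have hζ0 : ζ ≠ 0 := hζ.ne_zero (by omega)
  obtain ⟨a, rfl⟩ := exists_word hn hℓ hζ f
  obtain ⟨b, rfl⟩ := exists_word hn hℓ hζ g
  obtain ⟨c, rfl⟩ := exists_word hn hℓ hζ h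
  apply Units.ext
  rw [Units.val_mul, ← word_add, alphaFun_word, alphaFun_word, alphaFun_word, ← zpow_add₀ hζ0]
  simp only [Pi.add_apply, add_mul, Finset.sum_add_distrib, neg_add]

theorem alphaFun_mul_right (f g h : diagGroup n ℓ) :
    alphaFun hn hℓ hζ f (g * h) = alphaFun hn hℓ hζ f g * alphaFun hn hℓ hζ f h := by
  have hζ0 : ζ ≠ 0 := hζ.ne_zero (by omega)
  obtain ⟨a, rfl⟩ := exists_word hn hℓ hζ f
  obtain ⟨b, rfl⟩ := exists_word hn hℓ hζ g
  obtain ⟨c, rfl⟩ := exists_word hn hℓ hζ h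
  apply Units.ext
  rw [Units.val_mul, ← word_add, alphaFun_word, alphaFun_word, alphaFun_word, ← zpow_add₀ hζ0]
  simp only [Pi.add_apply, mul_add, Finset.sum_add_distrib, neg_add]

/-- The 2-cocycle `α` of the group. -/
def alpha : TwoCocycle (diagGroup n ℓ) where
  toFun := alphaFun hn hℓ hζ
  cocycle f g h := by
    rw [alphaFun_mul_left, alphaFun_mul_right]
    rw [← mul_assoc, mul_comm]
  one_left g := by
    simpa using alphaFun_mul_left hn hℓ hζ 1 1 g
  one_right g := by
    simpa using alphaFun_mul_right hn hℓ hζ g 1 1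

end Cocycle

/-! ### The tensor algebra with its group action -/

/-- The tensor algebra `TV` of `V = ℂ^n`. -/
abbrev TV (n : ℕ) : Type := TensorAlgebra ℂ (Fin n → ℂ)

/-- The endomorphism of `TV` induced by the linear action of a matrix on `V`. -/
def actHom (n ℓ : ℕ) : diagGroup n ℓ →* (TV n →ₐ[ℂ] TV n) where
  toFun g := TensorAlgebra.lift ℂ ((TensorAlgebra.ι ℂ).comp (Matrix.toLin' g.1.1))
  map_one' := by
    apply TensorAlgebra.hom_ext
    ext i
    simp
  map_mul' g h := by
    apply TensorAlgebra.hom_ext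
    refine LinearMap.ext fun v => ?_
    simp [Matrix.mulVec_mulVec]

/-- The action of the group on `TV` by algebra automorphisms. -/
def act (n ℓ : ℕ) : diagGroup n ℓ →* (TV n ≃ₐ[ℂ] TV n) :=
  (AlgEquiv.algHomUnitsEquiv ℂ (TV n)).toMonoidHom.comp (actHom n ℓ).toHomUnits

theorem act_ι (n ℓ : ℕ) (g : diagGroup n ℓ) (v : Fin n → ℂ) :
    act n ℓ g (TensorAlgebra.ι ℂ v) = TensorAlgebra.ι ℂ (Matrix.mulVec g.1.1 v) := by
  change actHom n ℓ g (TensorAlgebra.ι ℂ v) = _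
  simp [actHom]

/-! ### The twisted graded Hecke algebra -/

section Hecke

variable {n ℓ : ℕ} [NeZero n] (hn : 3 ≤ n) (hℓ : 2 ≤ ℓ) {ζ : ℂ} (hζ : IsPrimitiveRoot ζ ℓ)

/-- The crossed product `TV #_α G`. -/
abbrev TVG : Type := CrossedProduct (act n ℓ) (alpha hn hℓ hζ)

/-- The basis vector `x_i` of `V`, as the element `x_i ⊗ 1` of `TV #_α G`. -/
def xT (i : Fin n) : TVG hn hℓ hζ :=
  CrossedProduct.tmul _ _ (TensorAlgebra.ι ℂ (Pi.single i 1)) 1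

/-- A group element `g`, as the element `1 ⊗ g` of `TV #_α G`. -/
def gT (g : diagGroup n ℓ) : TVG hn hℓ hζ := CrossedProduct.tmul _ _ 1 g

/-- Cyclic adjacency of indices. -/
def Adjacent (i j : Fin n) : Prop := j = i + 1 ∨ i = j + 1

/-- The defining relations of the twisted graded Hecke algebra. -/
inductive Rel (t : Fin n → ℂ) : TVG hn hℓ hζ → TVG hn hℓ hζ → Prop
  | adjacent (i : Fin n) :
      Rel t (xT hn hℓ hζ i * xT hn hℓ hζ (i + 1) - xT hn hℓ hζ (i + 1) * xT hn hℓ hζ i)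
        (t i • gT hn hℓ hζ (gen hn hℓ hζ i))
  | nonadjacent (i j : Fin n) (hij : ¬ Adjacent i j) :
      Rel t (xT hn hℓ hζ i * xT hn hℓ hζ j - xT hn hℓ hζ j * xT hn hℓ hζ i) 0

/-- The twisted graded Hecke algebra `H`. -/
def Hecke (t : Fin n → ℂ) : Type := RingQuot (Rel hn hℓ hζ t)

instance (t : Fin n → ℂ) : Ring (Hecke hn hℓ hζ t) :=
  inferInstanceAs (Ring (RingQuot (Rel hn hℓ hζ t)))

instance (t : Fin n → ℂ) : Algebra ℂ (Hecke hn hℓ hζ t) :=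
  inferInstanceAs (Algebra ℂ (RingQuot (Rel hn hℓ hζ t)))

variable (t : Fin n → ℂ)

/-- The quotient map `TV #_α G → H`. -/
def Hecke.mk : TVG hn hℓ hζ →ₐ[ℂ] Hecke hn hℓ hζ t := RingQuot.mkAlgHom ℂ (Rel hn hℓ hζ t)

/-- The generator `x_i` of `H`. -/
def Hecke.x (i : Fin n) : Hecke hn hℓ hζ t := Hecke.mk hn hℓ hζ t (xT hn hℓ hζ i)

/-- The generator `g_i`, as an element of `H`. -/
def Hecke.g (i : Fin n) : Hecke hn hℓ hζ t := Hecke.mk hn hℓ hζ t (gT hn hℓ hζ (gen hn hℓ hζ i))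

/-- The index sets without two cyclically adjacent elements. -/
def nonadjacentSets (n : ℕ) [NeZero n] : Finset (Finset (Fin n)) :=
  open Classical in
  Finset.univ.filter fun S => ∀ i ∈ S, ∀ j ∈ S, ¬ Adjacent i j

/-- `δ = (1, …, 1)`. -/
def delta (n : ℕ) : Fin n → ℤ := fun _ => 1

/-- `ε_i`, with entries `1` at `i` and (cyclically) `i + 1`, and `0` elsewhere. -/
def eps {n : ℕ} [NeZero n] (i : Fin n) : Fin n → ℤ := Pi.single i 1 + Pi.single (i + 1) 1

/-- The exponents that occur in `w` are nonnegative. -/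
theorem exponent_nonneg {S : Finset (Fin n)} (hS : S ∈ nonadjacentSets n) (j : Fin n) :
    0 ≤ (delta n - ∑ i ∈ S, eps i) j := by
  have hS' : ∀ i ∈ S, ∀ j ∈ S, ¬ Adjacent i j := by
    simpa [nonadjacentSets] using hS
  have h1 : (∑ i ∈ S, eps i) j = (if j ∈ S then 1 else 0) + (if j - 1 ∈ S then 1 else 0) := by
    simp only [Finset.sum_apply, eps, Pi.add_apply, Finset.sum_add_distrib, Pi.single_apply]
    simp [← sub_eq_iff_eq_add]
  rw [Pi.sub_apply, h1, delta]
  by_cases ha : j ∈ S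
  · by_cases hb : j - 1 ∈ S
    · exact absurd (Or.inl (by simp)) (hS' _ hb _ ha)
    · simp [ha, hb]
  · split_ifs <;> simp

/-- `x^p = x_1^{p_1} ⋯ x_n^{p_n}`, the factors in increasing order, for an exponent vector
`p` with nonnegative entries. -/
def Hecke.xpow (p : Fin n → ℤ) : Hecke hn hℓ hζ t :=
  (List.ofFn fun j => Hecke.x hn hℓ hζ t j ^ (p j).toNat).prod

/-- `τ_i = t_i / (ζ - 1)` for `i < n`, and `τ_n = ζ t_n / (ζ - 1)`; the last index is
`n - 1` here. -/
def tau (ζ : ℂ) (t : Fin n → ℂ) (i : Fin n) : ℂ :=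
  if i.val = n - 1 then ζ * t i / (ζ - 1) else t i / (ζ - 1)

/-- The element `w` of `H`. -/
def Hecke.w : Hecke hn hℓ hζ t :=
  ∑ S ∈ nonadjacentSets n, (∏ i ∈ S, tau ζ t i) •
    (Hecke.xpow hn hℓ hζ t (delta n - ∑ i ∈ S, eps i) *
      ((S.sort (· ≤ ·)).map (Hecke.g hn hℓ hζ t)).prod)

end Hecke

end HomocyclicHecke

end

/-! The Hecke algebra embeds in a quantum torus, where leading terms and centers are easy to read
off. `Torus` is spanned by the monomials z^p g with p in ℤ^n, multiplied through the cocycle α. The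
ratio α(h, g_i) / α(g_i, h) is the weight of x_i x_{i+1} at h (`alphaFun_gen_comm`). Hence b_i =
-(t_{i-1} / (ζ - 1)) z_{i-1}⁻¹ g_{i-1} transforms under the group exactly like z_i. Moreover the b_i
commute with each other, and b_i commutes with z_j up to a factor 1, ζ or ζ⁻¹. Therefore x_i ↦ z_i +
b_i respects the defining relations and yields `toTorus`.

Since b_i has degree -1, a word in the x_i followed by a group element has as leading term the
corresponding monomial in the z_i. Permuting the letters of a word changes it only in lower degree,
so leading coefficients determine an element modulo lower degree; this gives `toTorus_injective`.

The image of w is z_1 ⋯ z_n + b_1 ⋯ b_n (`toTorus_w`): the mixed terms in the expansion of ∏ (z_i +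
b_i) are cancelled by the other summands of w, by an alternating sum over subsets. Both remaining
products are multiples of monomials z^{(k, …, k)}, central because the group has determinant one.
The powers x_i ^ ℓ are central because moving x_j past x_i ^ ℓ produces a vanishing geometric sum of
roots of unity.

Conversely, let z^p g occur in top degree in the image of a central element. Commuting with the x_i
forces g = 1, and commuting with the group forces all p_i to agree modulo ℓ. Since also p ≥ 0, z^p
is the leading monomial of a product of powers of the x_i ^ ℓ and of w. Subtracting such products
lowers the degree, and induction finishes (`mem_centralSubalgebra_of_mem_degLT`). -/

noncomputable section

namespace HomocyclicHecke

/-! ### Homomorphisms out of crossed products -/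

namespace CrossedProduct

variable {G E B : Type*} [Group G] [Ring E] [Algebra ℂ E] [Ring B] [Algebra ℂ B]
  {ρ : G →* (E ≃ₐ[ℂ] E)} {α : TwoCocycle G}

/-- The linear map `r ⊗ g ↦ φ r * u g`. -/
def liftLinear (φ : E →ₐ[ℂ] B) (u : G → B) : CrossedProduct ρ α →ₗ[ℂ] B :=
  (Finsupp.lsum ℂ fun g => (LinearMap.mulRight ℂ (u g)).comp φ.toLinearMap : (G →₀ E) →ₗ[ℂ] B)

theorem liftLinear_tmul (φ : E →ₐ[ℂ] B) (u : G → B) (r : E) (g : G) :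
    liftLinear φ u (tmul ρ α r g) = φ r * u g := by
  refine (Finsupp.lsum_single ℂ _ g r).trans ?_
  simp

/-- The universal property of the crossed product. -/
def lift (φ : E →ₐ[ℂ] B) (u : G → B) (map_one : u 1 = 1)
    (map_mul : ∀ g h, u g * u h = (α.toFun g h : ℂ) • u (g * h))
    (map_act : ∀ g s, u g * φ s = φ (ρ g s) * u g) : CrossedProduct ρ α →ₐ[ℂ] B :=
  AlgHom.ofLinearMap (liftLinear φ u) (by
    rw [one_def, liftLinear_tmul, map_one, _root_.map_one, mul_one])
    (by
      intro a b
      induction a using CrossedProduct.induction with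
      | zero => simp
      | add a a' h h' => simp only [add_mul, _root_.map_add, h, h']
      | tmul r g =>
      induction b using CrossedProduct.induction with
      | zero => simp
      | add a a' h h' => simp only [mul_add, _root_.map_add, h, h']
      | tmul s h =>
        rw [tmul_mul_tmul, liftLinear_tmul, liftLinear_tmul, liftLinear_tmul, map_smul,
          _root_.map_mul,
          mul_assoc (φ r), ← mul_assoc (u g), map_act, mul_assoc, map_mul, smul_mul_assoc,
          mul_smul_comm, mul_smul_comm, mul_assoc])

theorem lift_tmul (φ : E →ₐ[ℂ] B) (u : G → B) (map_one : u 1 = 1)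
    (map_mul : ∀ g h, u g * u h = (α.toFun g h : ℂ) • u (g * h))
    (map_act : ∀ g s, u g * φ s = φ (ρ g s) * u g) (r : E) (g : G) :
    lift (ρ := ρ) φ u map_one map_mul map_act (tmul ρ α r g) = φ r * u g :=
  liftLinear_tmul φ u r g

end CrossedProduct

/-! ### Characters of the group and the commutator of the cocycle -/

section Group

variable {n ℓ : ℕ}

/-- The `j`-th diagonal entry, as a character of the group. -/
def entry (j : Fin n) : diagGroup n ℓ →* ℂˣ :=
  MonoidHom.toHomUnits
    { toFun := fun g => g.1.1 j j
      map_one' := Matrix.one_apply_eq j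
      map_mul' := fun g h => mul_diag g h j }

theorem entry_val (j : Fin n) (g : diagGroup n ℓ) : (entry j g : ℂ) = g.1.1 j j := rfl

theorem eq_of_entry_eq {g h : diagGroup n ℓ} (H : ∀ j, entry j g = entry j h) : g = h :=
  ext_diag fun j => congrArg Units.val (H j)

theorem prod_entry (g : diagGroup n ℓ) : ∏ j, entry j g = 1 := by
  apply Units.ext
  have hf : (g.1 : Matrix (Fin n) (Fin n) ℂ).det = 1 := g.1.2
  rw [coe_eq_diagonal, Matrix.det_diagonal] at hf
  simpa [entry_val] using hf

theorem entry_pow (j : Fin n) (g : diagGroup n ℓ) : entry j g ^ ℓ = 1 := by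
  have hg : g ^ ℓ = 1 := Subtype.ext g.2.2
  rw [← map_pow, hg, map_one]

/-- The character by which the group acts on the Laurent monomial with exponent `q`. -/
def weight (q : Fin n → ℤ) (g : diagGroup n ℓ) : ℂˣ := ∏ j, entry j g ^ q j

theorem weight_add (p q : Fin n → ℤ) (g : diagGroup n ℓ) :
    weight (p + q) g = weight p g * weight q g := by
  simp [weight, zpow_add, Finset.prod_mul_distrib]

theorem weight_neg (p : Fin n → ℤ) (g : diagGroup n ℓ) :
    weight (-p) g = (weight p g)⁻¹ := by
  simp [weight]

theorem weight_mul (p : Fin n → ℤ) (g h : diagGroup n ℓ) :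
    weight p (g * h) = weight p g * weight p h := by
  simp [weight, mul_zpow, Finset.prod_mul_distrib]

@[simp] theorem weight_one (p : Fin n → ℤ) : weight p (1 : diagGroup n ℓ) = 1 := by
  simp [weight]

@[simp] theorem weight_zero (g : diagGroup n ℓ) : weight 0 g = 1 := by
  simp [weight]

theorem weight_single (i : Fin n) (g : diagGroup n ℓ) :
    weight (Pi.single i 1) g = entry i g := by
  rw [weight, Finset.prod_eq_single i]
  · simp
  · intro j _ hj
    simp [hj]
  · simp

/-- Determinant one, in multiplicative form; it makes z^{(k, …, k)} central in the torus. -/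
theorem weight_const (k : ℤ) (g : diagGroup n ℓ) : weight (fun _ => k) g = 1 := by
  simp only [weight]
  rw [Finset.prod_zpow, prod_entry, one_zpow]

variable [NeZero n] (hn : 3 ≤ n) (hℓ : 2 ≤ ℓ) {ζ : ℂ} (hζ : IsPrimitiveRoot ζ ℓ)

theorem entry_gen (i j : Fin n) : (entry j (gen hn hℓ hζ i) : ℂ) = genEntry ζ i j :=
  Matrix.diagonal_apply_eq _ j

/-- At each diagonal position j the entry ζ of g_j cancels the entry ζ⁻¹ of g_{j-1}. -/
theorem prod_gen : ∏ i, gen hn hℓ hζ i = 1 := by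
  refine eq_of_entry_eq fun j => Units.ext ?_
  rw [map_prod, map_one, Units.coe_prod]
  simp only [entry_gen, genEntry_eq hn, Finset.prod_mul_distrib]
  rw [Finset.prod_ite_eq, Finset.prod_eq_single (j - 1)]
  · simp [hζ.ne_zero (by omega)]
  · intro b _ hb
    rw [if_neg]
    rintro rfl
    simp at hb
  · simp

theorem word_single (k : ℕ) (hk : k < n - 1) :
    word hn hℓ hζ (Pi.single k 1) = gen hn hℓ hζ (Fin.ofNat n k) := by
  rw [word, Finset.prod_eq_single k]
  · simp
  · intro j _ hj
    simp [hj]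
  · intro h
    exact absurd (Finset.mem_range.2 hk) h

/-- The cocycle is given by a formula in the first n - 1 generators only; this brings the remaining
generator within its reach. -/
theorem word_neg_one :
    word hn hℓ hζ (fun _ => -1) = gen hn hℓ hζ (Fin.ofNat n (n - 1)) := by
  have h := prod_gen hn hℓ hζ
  have h2 : ∏ i, gen hn hℓ hζ i = ∏ k ∈ Finset.range n, gen hn hℓ hζ (Fin.ofNat n k) := by
    rw [← Fin.prod_univ_eq_prod_range (fun k => gen hn hℓ hζ (Fin.ofNat n k)) n]
    refine Finset.prod_congr rfl fun i _ => ?_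
    simp
  obtain ⟨m, rfl⟩ : ∃ m, n = m + 1 := ⟨n - 1, by omega⟩
  rw [h2, Finset.prod_range_succ] at h
  simp only [word, Nat.add_sub_cancel, zpow_neg, zpow_one, Finset.prod_inv_distrib]
  exact inv_eq_of_mul_eq_one_right h

theorem entry_word (a : ℕ → ℤ) (j : Fin n) :
    (entry j (word hn hℓ hζ a) : ℂ) =
      ζ ^ ((if j.val < n - 1 then a j else 0) - (if 1 ≤ j.val then a (j - 1) else 0)) := by
  have hζ0 : ζ ≠ 0 := hζ.ne_zero (by omega)
  have hval : ∀ k, k < n - 1 → (j = Fin.ofNat n k ↔ k = j.val) := by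
    intro k hk
    rw [Fin.ext_iff]
    simp [Fin.ofNat, Nat.mod_eq_of_lt (show k < n by omega), eq_comm]
  have hval' : ∀ k, k < n - 1 → (j = Fin.ofNat n k + 1 ↔ k + 1 = j.val) := by
    intro k hk
    rw [Fin.ext_iff, Fin.val_add, Fin.val_one', Nat.mod_eq_of_lt (show 1 < n by omega)]
    simp [Fin.ofNat, Nat.mod_eq_of_lt (show k < n by omega),
      Nat.mod_eq_of_lt (show k + 1 < n by omega), eq_comm]
  rw [word, map_prod, Units.coe_prod]
  have h1 : ∀ k ∈ Finset.range (n - 1),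
      ((entry j (gen hn hℓ hζ (Fin.ofNat n k) ^ a k) : ℂˣ) : ℂ)
        = (if k = j.val then ζ ^ a k else 1) * (if k + 1 = j.val then ζ ^ (- a k) else 1) := by
    intro k hk
    have hk := Finset.mem_range.1 hk
    rw [map_zpow, Units.val_zpow_eq_zpow_val, entry_gen, genEntry_eq hn, mul_zpow]
    simp only [hval k hk, hval' k hk]
    congr 1 <;> split_ifs <;> simp
  rw [Finset.prod_congr rfl h1, Finset.prod_mul_distrib, sub_eq_add_neg, zpow_add₀ hζ0]
  congr 1
  · rw [Finset.prod_ite_eq']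
    simp only [Finset.mem_range]
    split_ifs <;> simp
  · by_cases hj : 1 ≤ j.val
    · rw [Finset.prod_eq_single (j.val - 1)]
      · rw [if_pos (by omega), if_pos hj]
      · intro b _ hb
        rw [if_neg (by omega)]
      · intro h
        have := j.2
        exact absurd (Finset.mem_range.2 (by omega)) h
    · rw [Finset.prod_eq_one, if_neg hj]
      · simp
      · intro k _
        rw [if_neg (by omega)]

/-- The commutator pairing of the cocycle with `g_i` is the weight of `x_i x_{i+1}`. -/
theorem alphaFun_gen_comm (h : diagGroup n ℓ) (i : Fin n) :
    alphaFun hn hℓ hζ h (gen hn hℓ hζ i)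
      = alphaFun hn hℓ hζ (gen hn hℓ hζ i) h * (entry i h * entry (i + 1) h) := by
  have hζ0 : ζ ≠ 0 := hζ.ne_zero (by omega)
  obtain ⟨a, rfl⟩ := exists_word hn hℓ hζ h
  apply Units.ext
  obtain ⟨k, hk, rfl⟩ : ∃ k, k < n ∧ i = Fin.ofNat n k := ⟨i.val, i.2, by simp⟩
  have hv : (Fin.ofNat n k).val = k := by simp [Fin.ofNat, Nat.mod_eq_of_lt hk]
  have hv' : (Fin.ofNat n k + 1).val = if k = n - 1 then 0 else k + 1 := by
    rw [Fin.val_add, hv, Fin.val_one', Nat.mod_eq_of_lt (show 1 < n by omega)]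
    split_ifs with h
    · subst h
      rw [Nat.sub_add_cancel (by omega), Nat.mod_self]
    · rw [Nat.mod_eq_of_lt (by omega)]
  rw [Units.val_mul, Units.val_mul, entry_word, entry_word, hv, hv']
  by_cases hkn : k = n - 1
  · subst hkn
    rw [← word_neg_one, alphaFun_word, alphaFun_word, ← zpow_add₀ hζ0, ← zpow_add₀ hζ0]
    congr 1
    simp only [mul_neg, mul_one, neg_mul, one_mul, Finset.sum_neg_distrib, neg_neg, if_true]
    -- The two cocycle exponents are sums of a over 0, …, n - 3 and over 1, …, n - 2. Peeling the
    -- sum over 0, …, n - 2 at either end shows that they differ by a 0 - a (n - 2), the exponent of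
    -- the two entries.
    have := Finset.sum_range_succ' a (n - 2)
    rw [Finset.sum_range_succ] at this
    rw [if_neg (by omega), if_pos (by omega), if_pos (by omega), if_neg (by omega),
      show n - 1 - 1 = n - 2 by omega]
    linarith
  · rw [← word_single hn hℓ hζ k (by omega), alphaFun_word, alphaFun_word, ← zpow_add₀ hζ0,
      ← zpow_add₀ hζ0]
    congr 1
    -- Only one term of each sum survives, and none at the end k = 0 (here) or k = n - 2 (in `e2`).
    -- These exceptions match the boundary cases of `entry_word`, where the terms a k of the two
    -- entries cancel.
    have e1 : ∑ m ∈ Finset.range (n - 2), a m * (Pi.single k 1 : ℕ → ℤ) (m + 1)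
        = if 1 ≤ k then a (k - 1) else 0 := by
      split_ifs with hk1
      · rw [Finset.sum_eq_single (k - 1)]
        · simp [Nat.sub_add_cancel hk1]
        · intro m _ hm
          rw [Pi.single_eq_of_ne (by omega), mul_zero]
        · intro h
          exact absurd (Finset.mem_range.2 (by omega)) h
      · refine Finset.sum_eq_zero fun m _ => ?_
        rw [Pi.single_eq_of_ne (by omega), mul_zero]
    have e2 : ∑ m ∈ Finset.range (n - 2), (Pi.single k 1 : ℕ → ℤ) m * a (m + 1)
        = if k + 1 < n - 1 then a (k + 1) else 0 := by
      split_ifs with hk1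
      · rw [Finset.sum_eq_single k]
        · simp
        · intro m _ hm
          rw [Pi.single_eq_of_ne hm, zero_mul]
        · intro h
          exact absurd (Finset.mem_range.2 (by omega)) h
      · refine Finset.sum_eq_zero fun m hm => ?_
        have := Finset.mem_range.1 hm
        rw [Pi.single_eq_of_ne (by omega), zero_mul]
    rw [e1, e2]
    simp only [if_neg hkn]
    rw [if_pos (show k < n - 1 by omega), if_pos (show 1 ≤ k + 1 by omega), Nat.add_sub_cancel]
    ring

end Group

/-! ### The quantum torus `ℂ[z₁^{±1}, …, z_n^{±1}] #_α G` -/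

section Torus

variable {n ℓ : ℕ} [NeZero n] (hn : 3 ≤ n) (hℓ : 2 ≤ ℓ) {ζ : ℂ} (hζ : IsPrimitiveRoot ζ ℓ)

theorem alphaFun_one_left (g : diagGroup n ℓ) : alphaFun hn hℓ hζ 1 g = 1 :=
  (alpha hn hℓ hζ).one_left g

theorem alphaFun_one_right (g : diagGroup n ℓ) : alphaFun hn hℓ hζ g 1 = 1 :=
  (alpha hn hℓ hζ).one_right g

/-- The group of monomials `z^p g`, up to scalars. -/
abbrev MonomialGroup (n ℓ : ℕ) : Type := Multiplicative (Fin n → ℤ) × diagGroup n ℓ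

/-- The cocycle describing the multiplication of the monomials `z^p g`. -/
def torusCocycle : TwoCocycle (MonomialGroup n ℓ) where
  toFun a b := alphaFun hn hℓ hζ a.2 b.2 * weight (Multiplicative.toAdd b.1) a.2
  cocycle f g h := by
    simp only [Prod.snd_mul, Prod.fst_mul, toAdd_mul, alphaFun_mul_left, alphaFun_mul_right,
      weight_add, weight_mul]
    simp only [mul_comm, mul_left_comm, mul_assoc]
  one_left g := by
    simp [alphaFun_one_left]
  one_right g := by
    simp [alphaFun_one_right]

/-- The quantum torus `ℂ[z₁^{±1}, …, z_n^{±1}] #_α G`, as a twisted group algebra. -/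
abbrev Torus : Type :=
  CrossedProduct (1 : MonomialGroup n ℓ →* (ℂ ≃ₐ[ℂ] ℂ)) (torusCocycle hn hℓ hζ)

/-- The monomial `z^p g`. -/
def mono (p : Fin n → ℤ) (g : diagGroup n ℓ) : Torus hn hℓ hζ :=
  CrossedProduct.tmul _ _ 1 (Multiplicative.ofAdd p, g)

theorem mono_mul (p q : Fin n → ℤ) (g h : diagGroup n ℓ) :
    mono hn hℓ hζ p g * mono hn hℓ hζ q h
      = ((alphaFun hn hℓ hζ g h * weight q g : ℂˣ) : ℂ) • mono hn hℓ hζ (p + q) (g * h) := by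
  rw [mono, mono, CrossedProduct.tmul_mul_tmul, mono, CrossedProduct.smul_tmul]
  change CrossedProduct.tmul _ _ (_ • ((1 : ℂ) * 1)) _ = _
  rw [mul_one]
  rfl

/-- The coefficient of `z^p g`. -/
def coeff (p : Fin n → ℤ) (g : diagGroup n ℓ) : Torus hn hℓ hζ →ₗ[ℂ] ℂ :=
  (Finsupp.lapply (Multiplicative.ofAdd p, g) : (MonomialGroup n ℓ →₀ ℂ) →ₗ[ℂ] ℂ)

open Classical in
theorem coeff_mono (p q : Fin n → ℤ) (g h : diagGroup n ℓ) :
    coeff hn hℓ hζ p g (mono hn hℓ hζ q h) = if q = p ∧ h = g then 1 else 0 := by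
  refine (Finsupp.single_apply (a := ((Multiplicative.ofAdd q, h) : MonomialGroup n ℓ))
    (a' := (Multiplicative.ofAdd p, g)) (b := (1 : ℂ))).trans ?_
  simp [Prod.ext_iff]

theorem torus_induction {P : Torus hn hℓ hζ → Prop} (f : Torus hn hℓ hζ) (zero : P 0)
    (add : ∀ a b, P a → P b → P (a + b))
    (smul_mono : ∀ (c : ℂ) p g, P (c • mono hn hℓ hζ p g)) : P f :=
  CrossedProduct.induction f zero add fun r g => by
    have := smul_mono r (Multiplicative.toAdd g.1) g.2
    rw [mono, CrossedProduct.smul_tmul] at this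
    simpa using this

theorem coeff_mono_mul (p q : Fin n → ℤ) (g h : diagGroup n ℓ) (f : Torus hn hℓ hζ) :
    coeff hn hℓ hζ (p + q) (g * h) (mono hn hℓ hζ p g * f)
      = ((alphaFun hn hℓ hζ g h * weight q g : ℂˣ) : ℂ) * coeff hn hℓ hζ q h f := by
  classical
  induction f using torus_induction with
  | zero => simp
  | add a b ha hb => simp only [mul_add, map_add, ha, hb]
  | smul_mono c r k =>
    rw [mul_smul_comm, mono_mul]
    simp only [map_smul, coeff_mono, smul_eq_mul, add_right_inj, mul_right_inj]
    by_cases H : r = q ∧ k = h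
    · obtain ⟨rfl, rfl⟩ := H
      simp [mul_comm]
    · simp [H]

theorem coeff_mul_mono (p q : Fin n → ℤ) (g h : diagGroup n ℓ) (f : Torus hn hℓ hζ) :
    coeff hn hℓ hζ (p + q) (g * h) (f * mono hn hℓ hζ q h)
      = ((alphaFun hn hℓ hζ g h * weight q g : ℂˣ) : ℂ) * coeff hn hℓ hζ p g f := by
  classical
  induction f using torus_induction with
  | zero => simp
  | add a b ha hb => simp only [add_mul, mul_add, map_add, ha, hb]
  | smul_mono c r k =>
    rw [smul_mul_assoc, mono_mul]
    simp only [map_smul, coeff_mono, smul_eq_mul, add_left_inj, mul_left_inj]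
    by_cases H : r = p ∧ k = g
    · obtain ⟨rfl, rfl⟩ := H
      simp [mul_comm]
    · simp [H]

theorem mono_mul_comm {p q : Fin n → ℤ} {g h : diagGroup n ℓ} (κ : ℂˣ)
    (H : alphaFun hn hℓ hζ g h * weight q g = κ * (alphaFun hn hℓ hζ h g * weight p h)) :
    mono hn hℓ hζ p g * mono hn hℓ hζ q h
      = (κ : ℂ) • (mono hn hℓ hζ q h * mono hn hℓ hζ p g) := by
  rw [mono_mul, mono_mul, H, smul_smul, add_comm p, mul_comm g, Units.val_mul κ]

/-- `z^{(k, …, k)}` is central. -/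
theorem mono_const_comm (k : ℤ) (f : Torus hn hℓ hζ) :
    mono hn hℓ hζ (fun _ => k) 1 * f = f * mono hn hℓ hζ (fun _ => k) 1 := by
  induction f using torus_induction with
  | zero => simp
  | add a b ha hb => simp only [mul_add, add_mul, ha, hb]
  | smul_mono c q h =>
    rw [mul_smul_comm, smul_mul_assoc, mono_mul_comm hn hℓ hζ 1 (by
      rw [alphaFun_one_left, alphaFun_one_right, weight_one, weight_const, one_mul, one_mul]),
      Units.val_one, one_smul]

/-- The group element `g` in the quantum torus. -/
def gL (g : diagGroup n ℓ) : Torus hn hℓ hζ := mono hn hℓ hζ 0 g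

/-- The coordinate `z_i`. -/
def zL (i : Fin n) : Torus hn hℓ hζ := mono hn hℓ hζ (Pi.single i 1) 1

/-- The coefficient `t_i / (ζ - 1)`. -/
def sigma (ζ : ℂ) (t : Fin n → ℂ) (i : Fin n) : ℂ := t i / (ζ - 1)

/-- The element `- (t_{i-1} / (ζ - 1)) z_{i-1}⁻¹ g_{i-1}`. -/
def bL (t : Fin n → ℂ) (i : Fin n) : Torus hn hℓ hζ :=
  (- sigma ζ t (i - 1)) • mono hn hℓ hζ (- Pi.single (i - 1) 1) (gen hn hℓ hζ (i - 1))

theorem gL_one : gL hn hℓ hζ 1 = 1 := rfl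

theorem gL_mul (g h : diagGroup n ℓ) :
    gL hn hℓ hζ g * gL hn hℓ hζ h = (alphaFun hn hℓ hζ g h : ℂ) • gL hn hℓ hζ (g * h) := by
  rw [gL, gL, mono_mul, weight_zero, mul_one, add_zero, gL]

theorem gL_mul_zL (h : diagGroup n ℓ) (i : Fin n) :
    gL hn hℓ hζ h * zL hn hℓ hζ i = (entry i h : ℂ) • (zL hn hℓ hζ i * gL hn hℓ hζ h) :=
  mono_mul_comm hn hℓ hζ _ (by
    simp [alphaFun_one_left, alphaFun_one_right, weight_single])

/-- The cocycle commutator with g_{i-1} contributes the entries i - 1 and i of h, and z_{i-1}⁻¹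
removes the entry i - 1. So b_i has the weight of z_i, which is what makes z_i + b_i homogeneous
under the group. -/
theorem gL_mul_bL (t : Fin n → ℂ) (h : diagGroup n ℓ) (i : Fin n) :
    gL hn hℓ hζ h * bL hn hℓ hζ t i = (entry i h : ℂ) • (bL hn hℓ hζ t i * gL hn hℓ hζ h) := by
  rw [bL, mul_smul_comm, smul_mul_assoc, gL, mono_mul_comm hn hℓ hζ (entry i h), smul_comm]
  rw [alphaFun_gen_comm, weight_neg, weight_single, weight_zero, mul_one, sub_add_cancel]
  rw [mul_assoc, mul_comm (entry (i - 1) h), mul_assoc, mul_inv_cancel, mul_one, mul_comm]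

theorem zL_mul_zL (i j : Fin n) :
    zL hn hℓ hζ i * zL hn hℓ hζ j = zL hn hℓ hζ j * zL hn hℓ hζ i := by
  have := mono_mul_comm hn hℓ hζ (p := Pi.single i 1) (q := Pi.single j 1) (g := 1) (h := 1) 1
    (by simp)
  rwa [Units.val_one, one_smul] at this

theorem bL_mul_zL (t : Fin n → ℂ) (i j : Fin n) :
    bL hn hℓ hζ t i * zL hn hℓ hζ j
      = genEntry ζ (i - 1) j • (zL hn hℓ hζ j * bL hn hℓ hζ t i) := by
  rw [bL, smul_mul_assoc, zL, mono_mul_comm hn hℓ hζ (entry j (gen hn hℓ hζ (i - 1))), entry_gen,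
    smul_comm, mul_smul_comm]
  simp [alphaFun_one_left, alphaFun_one_right, weight_single]

theorem genEntry_mul_genEntry (hn : 3 ≤ n) (ζ : ℂ) (hζ0 : ζ ≠ 0) (i j : Fin n) :
    genEntry ζ i (j + 1) * genEntry ζ j i = 1 := by
  rw [genEntry_eq hn, genEntry_eq hn]
  by_cases h : i = j
  · subst h
    simp [succ_ne hn, (succ_ne hn i).symm, hζ0]
  · by_cases h' : i = j + 1
    · subst h'
      simp [succ_ne hn, hζ0]
      grind
    · simp [h, h', Ne.symm h, Ne.symm h']

/-- The cocycle commutator of g_{i-1} and g_{j-1} is the weight of x_{j-1} x_j at g_{i-1}. Passing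
z_{j-1}⁻¹ cancels the first entry, and `genEntry_mul_genEntry` matches the second with the cost of
passing z_{i-1}⁻¹ on the other side. -/
theorem bL_mul_bL (t : Fin n → ℂ) (i j : Fin n) :
    bL hn hℓ hζ t i * bL hn hℓ hζ t j = bL hn hℓ hζ t j * bL hn hℓ hζ t i := by
  have key := mono_mul_comm hn hℓ hζ (p := - Pi.single (i - 1) 1) (q := - Pi.single (j - 1) 1)
    (g := gen hn hℓ hζ (i - 1)) (h := gen hn hℓ hζ (j - 1)) 1 (by
      have h := genEntry_mul_genEntry hn ζ (hζ.ne_zero (by omega)) (i - 1) (j - 1)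
      rw [← entry_gen hn hℓ hζ, ← entry_gen hn hℓ hζ, ← Units.val_mul, Units.val_eq_one] at h
      rw [alphaFun_gen_comm, weight_neg, weight_neg, weight_single, weight_single, one_mul,
        eq_inv_of_mul_eq_one_left h]
      simp [mul_assoc])
  rw [Units.val_one, one_smul] at key
  simp only [bL, smul_mul_smul_comm, key, mul_comm]

theorem zL_mul_bL_succ (t : Fin n → ℂ) (i : Fin n) :
    zL hn hℓ hζ i * bL hn hℓ hζ t (i + 1) = (- sigma ζ t i) • gL hn hℓ hζ (gen hn hℓ hζ i) := by
  rw [zL, bL, mul_smul_comm, mono_mul, add_sub_cancel_right]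
  simp [alphaFun_one_left, gL]

theorem zeta_sub_one_ne_zero (hℓ : 2 ≤ ℓ) (hζ : IsPrimitiveRoot ζ ℓ) : ζ - 1 ≠ 0 :=
  sub_ne_zero.2 (hζ.ne_one (by omega))

/-- The image of `x_i` in the quantum torus. -/
def xL (t : Fin n → ℂ) (i : Fin n) : Torus hn hℓ hζ := zL hn hℓ hζ i + bL hn hℓ hζ t i

theorem gL_mul_xL (t : Fin n → ℂ) (h : diagGroup n ℓ) (i : Fin n) :
    gL hn hℓ hζ h * xL hn hℓ hζ t i = (entry i h : ℂ) • (xL hn hℓ hζ t i * gL hn hℓ hζ h) := by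
  rw [xL, mul_add, add_mul, gL_mul_zL, gL_mul_bL, smul_add]

/-- The z's commute and the b's commute, so only the cross terms remain. -/
theorem xL_commutator (t : Fin n → ℂ) (i j : Fin n) :
    xL hn hℓ hζ t i * xL hn hℓ hζ t j - xL hn hℓ hζ t j * xL hn hℓ hζ t i
      = (1 - genEntry ζ (j - 1) i) • (zL hn hℓ hζ i * bL hn hℓ hζ t j)
        - (1 - genEntry ζ (i - 1) j) • (zL hn hℓ hζ j * bL hn hℓ hζ t i) := by
  simp only [xL, mul_add, add_mul, bL_mul_zL, zL_mul_zL hn hℓ hζ i j, bL_mul_bL hn hℓ hζ t i j,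
    sub_smul, one_smul]
  abel

theorem succ_succ_ne (hn : 3 ≤ n) (i : Fin n) : i + 1 + 1 ≠ i := by
  intro h
  rw [add_assoc] at h
  have h1 : (1 + 1 : Fin n) = 0 := by simpa using h
  have := congrArg Fin.val h1
  rw [Fin.val_add, Fin.val_one', Fin.val_zero, Nat.mod_eq_of_lt (show 1 < n by omega),
    Nat.mod_eq_of_lt (by omega)] at this
  omega

theorem xL_commutator_succ (t : Fin n → ℂ) (i : Fin n) :
    xL hn hℓ hζ t i * xL hn hℓ hζ t (i + 1) - xL hn hℓ hζ t (i + 1) * xL hn hℓ hζ t i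
      = t i • gL hn hℓ hζ (gen hn hℓ hζ i) := by
  have h1 : genEntry ζ (i + 1 - 1) i = ζ := by simp [genEntry]
  have h2 : genEntry ζ (i - 1) (i + 1) = 1 := by
    rw [genEntry, if_neg, if_neg]
    · rw [sub_add_cancel]
      exact succ_ne hn i
    · intro h
      apply succ_succ_ne hn (i - 1)
      rw [sub_add_cancel, h]
  rw [xL_commutator, h1, h2, sub_self, zero_smul, sub_zero, zL_mul_bL_succ, smul_smul]
  congr 1
  have := zeta_sub_one_ne_zero hℓ hζ
  rw [sigma]
  field_simp
  ring

theorem genEntry_of_not_adjacent {i j : Fin n} (hij : ¬ Adjacent i j) (hne : i ≠ j) :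
    genEntry ζ (j - 1) i = 1 := by
  rw [genEntry, if_neg, if_neg]
  · rwa [sub_add_cancel]
  · rintro rfl
    exact hij (Or.inl (by simp))

theorem xL_commutator_of_not_adjacent (t : Fin n → ℂ) {i j : Fin n} (hij : ¬ Adjacent i j) :
    xL hn hℓ hζ t i * xL hn hℓ hζ t j - xL hn hℓ hζ t j * xL hn hℓ hζ t i = 0 := by
  by_cases hne : i = j
  · subst hne
    exact sub_self _
  · rw [xL_commutator, genEntry_of_not_adjacent hij hne,
      genEntry_of_not_adjacent (fun h => hij h.symm) (Ne.symm hne)]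
    simp

/-! ### The homomorphism from the Hecke algebra to the quantum torus -/

/-- The homomorphism from the tensor algebra with `x_i ↦ xL i`. -/
def tensorHom (t : Fin n → ℂ) : TV n →ₐ[ℂ] Torus hn hℓ hζ :=
  TensorAlgebra.lift ℂ (Fintype.linearCombination ℂ (xL hn hℓ hζ t))

theorem tensorHom_ι (t : Fin n → ℂ) (v : Fin n → ℂ) :
    tensorHom hn hℓ hζ t (TensorAlgebra.ι ℂ v) = ∑ i, v i • xL hn hℓ hζ t i := by
  rw [tensorHom, TensorAlgebra.lift_ι_apply, Fintype.linearCombination_apply]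

theorem gL_mul_tensorHom (t : Fin n → ℂ) (g : diagGroup n ℓ) (s : TV n) :
    gL hn hℓ hζ g * tensorHom hn hℓ hζ t s
      = tensorHom hn hℓ hζ t (act n ℓ g s) * gL hn hℓ hζ g := by
  induction s using TensorAlgebra.induction with
  | algebraMap r => simp [Algebra.commutes]
  | ι v =>
    rw [act_ι, tensorHom_ι, tensorHom_ι, Finset.mul_sum, Finset.sum_mul]
    refine Finset.sum_congr rfl fun i _ => ?_
    rw [mul_smul_comm, gL_mul_xL, coe_eq_diagonal, Matrix.mulVec_diagonal, smul_mul_assoc,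
      smul_smul, mul_comm, entry_val]
  | mul a b ha hb =>
    rw [map_mul, map_mul, map_mul, ← mul_assoc, ha, mul_assoc, hb, mul_assoc]
  | add a b ha hb => rw [map_add, map_add, map_add, mul_add, add_mul, ha, hb]

theorem gL_mul' (g h : diagGroup n ℓ) : gL hn hℓ hζ g * gL hn hℓ hζ h
    = ((alpha hn hℓ hζ).toFun g h : ℂ) • gL hn hℓ hζ (g * h) := gL_mul hn hℓ hζ g h

/-- The homomorphism from `TV #_α G`. -/
def crossedHom (t : Fin n → ℂ) : TVG hn hℓ hζ →ₐ[ℂ] Torus hn hℓ hζ :=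
  CrossedProduct.lift (tensorHom hn hℓ hζ t) (gL hn hℓ hζ) (gL_one hn hℓ hζ) (gL_mul' hn hℓ hζ)
    (gL_mul_tensorHom hn hℓ hζ t)

theorem crossedHom_xT (t : Fin n → ℂ) (i : Fin n) :
    crossedHom hn hℓ hζ t (xT hn hℓ hζ i) = xL hn hℓ hζ t i := by
  rw [crossedHom, xT, CrossedProduct.lift_tmul, gL_one, mul_one, tensorHom_ι,
    Finset.sum_eq_single i]
  · simp
  · intro j _ hj
    simp [hj]
  · simp

theorem crossedHom_gT (t : Fin n → ℂ) (g : diagGroup n ℓ) :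
    crossedHom hn hℓ hζ t (gT hn hℓ hζ g) = gL hn hℓ hζ g := by
  rw [crossedHom, gT, CrossedProduct.lift_tmul, map_one, one_mul]

/-- The homomorphism from the Hecke algebra to the quantum torus. -/
def toTorus (t : Fin n → ℂ) : Hecke hn hℓ hζ t →ₐ[ℂ] Torus hn hℓ hζ :=
  RingQuot.liftAlgHom ℂ ⟨crossedHom hn hℓ hζ t, by
    intro a b h
    cases h with
    | adjacent i =>
      rw [map_sub, map_mul, map_mul, map_smul, crossedHom_xT, crossedHom_xT, crossedHom_gT,
        xL_commutator_succ]
    | nonadjacent i j hij =>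
      rw [map_sub, map_mul, map_mul, map_zero, crossedHom_xT, crossedHom_xT,
        xL_commutator_of_not_adjacent hn hℓ hζ t hij]⟩

theorem toTorus_mk (t : Fin n → ℂ) (a : TVG hn hℓ hζ) :
    toTorus hn hℓ hζ t (Hecke.mk hn hℓ hζ t a) = crossedHom hn hℓ hζ t a :=
  RingQuot.liftAlgHom_mkAlgHom_apply _ _ _ _

theorem toTorus_x (t : Fin n → ℂ) (i : Fin n) :
    toTorus hn hℓ hζ t (Hecke.x hn hℓ hζ t i) = xL hn hℓ hζ t i := by
  rw [Hecke.x, toTorus_mk, crossedHom_xT]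

/-- The image of a group element in the Hecke algebra. -/
def Hecke.ofGroup (t : Fin n → ℂ) (h : diagGroup n ℓ) : Hecke hn hℓ hζ t :=
  Hecke.mk hn hℓ hζ t (gT hn hℓ hζ h)

theorem toTorus_ofGroup (t : Fin n → ℂ) (h : diagGroup n ℓ) :
    toTorus hn hℓ hζ t (Hecke.ofGroup hn hℓ hζ t h) = gL hn hℓ hζ h := by
  rw [Hecke.ofGroup, toTorus_mk, crossedHom_gT]

end Torus

section Filtration

variable {n ℓ : ℕ} [NeZero n] (hn : 3 ≤ n) (hℓ : 2 ≤ ℓ) {ζ : ℂ} (hζ : IsPrimitiveRoot ζ ℓ)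
  (t : Fin n → ℂ)

/-! ### Generators of the Hecke algebra -/

theorem Hecke.ofGroup_mul (g h : diagGroup n ℓ) :
    Hecke.ofGroup hn hℓ hζ t g * Hecke.ofGroup hn hℓ hζ t h
      = (alphaFun hn hℓ hζ g h : ℂ) • Hecke.ofGroup hn hℓ hζ t (g * h) := by
  rw [Hecke.ofGroup, Hecke.ofGroup, ← map_mul, gT, gT, CrossedProduct.tmul_mul_tmul, map_one,
    mul_one, ← CrossedProduct.smul_tmul, map_smul]
  rfl

theorem gT_mul_xT (g : diagGroup n ℓ) (i : Fin n) :
    gT hn hℓ hζ g * xT hn hℓ hζ i = (entry i g : ℂ) • (xT hn hℓ hζ i * gT hn hℓ hζ g) := by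
  have h1 : Matrix.mulVec g.1.1 (Pi.single i 1) = (entry i g : ℂ) • Pi.single i (1 : ℂ) := by
    rw [coe_eq_diagonal, entry_val]
    ext j
    rw [Matrix.mulVec_diagonal]
    by_cases h : j = i
    · subst h; simp
    · simp [h]
  rw [gT, xT, CrossedProduct.tmul_mul_tmul, CrossedProduct.tmul_mul_tmul,
    (alpha hn hℓ hζ).one_left, (alpha hn hℓ hζ).one_right, act_ι, h1, CrossedProduct.smul_tmul]
  simp

theorem Hecke.ofGroup_mul_x (g : diagGroup n ℓ) (i : Fin n) :
    Hecke.ofGroup hn hℓ hζ t g * Hecke.x hn hℓ hζ t i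
      = (entry i g : ℂ) • (Hecke.x hn hℓ hζ t i * Hecke.ofGroup hn hℓ hζ t g) := by
  rw [Hecke.ofGroup, Hecke.x, ← map_mul, gT_mul_xT, map_smul, map_mul]

/-- Forgetting which multiple occurs keeps just what the filtration needs: exchanging two letters
costs a term with two letters fewer. -/
theorem Hecke.x_commutator (i j : Fin n) : ∃ (c : ℂ) (g : diagGroup n ℓ),
    Hecke.x hn hℓ hζ t i * Hecke.x hn hℓ hζ t j - Hecke.x hn hℓ hζ t j * Hecke.x hn hℓ hζ t i
      = c • Hecke.ofGroup hn hℓ hζ t g := by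
  have rel : ∀ a b, Rel hn hℓ hζ t a b → Hecke.mk hn hℓ hζ t a = Hecke.mk hn hℓ hζ t b :=
    fun a b h => RingQuot.mkAlgHom_rel ℂ h
  have succ : ∀ i : Fin n, Hecke.x hn hℓ hζ t i * Hecke.x hn hℓ hζ t (i + 1)
      - Hecke.x hn hℓ hζ t (i + 1) * Hecke.x hn hℓ hζ t i
      = t i • Hecke.ofGroup hn hℓ hζ t (gen hn hℓ hζ i) := by
    intro i
    have := rel _ _ (Rel.adjacent i)
    rwa [map_sub, map_mul, map_mul, map_smul] at this
  by_cases hij : Adjacent i j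
  · rcases hij with rfl | rfl
    · exact ⟨_, _, succ i⟩
    · exact ⟨- t j, gen hn hℓ hζ j, by rw [neg_smul, ← succ j, neg_sub]⟩
  · refine ⟨0, 1, ?_⟩
    have := rel _ _ (Rel.nonadjacent i j hij)
    rwa [map_sub, map_mul, map_mul, map_zero, ← zero_smul ℂ (Hecke.ofGroup hn hℓ hζ t 1)] at this

/-- An induction principle: the algebra is spanned by words in the x_i followed by a group element,
and such words are built by left multiplication. -/
theorem Hecke.submodule_eq_top (N : Submodule ℂ (Hecke hn hℓ hζ t))
    (ofGroup_mem : ∀ h, Hecke.ofGroup hn hℓ hζ t h ∈ N)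
    (x_mul_mem : ∀ i, ∀ y ∈ N, Hecke.x hn hℓ hζ t i * y ∈ N) : N = ⊤ := by
  rw [Submodule.eq_top_iff']
  intro y
  obtain ⟨a, rfl⟩ := RingQuot.mkAlgHom_surjective ℂ (Rel hn hℓ hζ t) y
  change Hecke.mk hn hℓ hζ t a ∈ N
  have tens : ∀ r : TV n, ∀ y ∈ N, Hecke.mk hn hℓ hζ t (CrossedProduct.tmul _ _ r 1) * y ∈ N := by
    intro r
    induction r using TensorAlgebra.induction with
    | algebraMap c =>
      intro y hy
      have : (CrossedProduct.tmul _ _ (algebraMap ℂ (TV n) c) 1 : TVG hn hℓ hζ) = c • 1 := by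
        rw [Algebra.algebraMap_eq_smul_one, ← CrossedProduct.smul_tmul]
        rfl
      rw [this, map_smul, map_one, smul_mul_assoc, one_mul]
      exact N.smul_mem c hy
    | ι v =>
      intro y hy
      have : (CrossedProduct.tmul _ _ (TensorAlgebra.ι ℂ v) 1 : TVG hn hℓ hζ)
          = ∑ i, v i • xT hn hℓ hζ i := by
        have hv : v = ∑ i, v i • Pi.single i (1 : ℂ) := by
          rw [← pi_eq_sum_univ']
        conv_lhs => rw [hv, map_sum]
        simp only [xT, map_smul, CrossedProduct.smul_tmul]
        exact Finsupp.single_finsetSum _ _ _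
      rw [this, map_sum, Finset.sum_mul]
      refine N.sum_mem fun i _ => ?_
      rw [map_smul, smul_mul_assoc]
      exact N.smul_mem _ (x_mul_mem i y hy)
    | mul a b ha hb =>
      intro y hy
      have : (CrossedProduct.tmul _ _ (a * b) 1 : TVG hn hℓ hζ)
          = CrossedProduct.tmul _ _ a 1 * CrossedProduct.tmul _ _ b 1 := by
        rw [CrossedProduct.tmul_mul_tmul, (alpha hn hℓ hζ).one_left]
        simp
      rw [this, map_mul, mul_assoc]
      exact ha _ (hb _ hy)
    | add a b ha hb =>
      intro y hy
      have : (CrossedProduct.tmul _ _ (a + b) 1 : TVG hn hℓ hζ)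
          = CrossedProduct.tmul _ _ a 1 + CrossedProduct.tmul _ _ b 1 :=
        Finsupp.single_add _ _ _
      rw [this, map_add, add_mul]
      exact N.add_mem (ha _ hy) (hb _ hy)
  induction a using CrossedProduct.induction with
  | zero => rw [map_zero]; exact N.zero_mem
  | add a b ha hb => rw [map_add]; exact N.add_mem ha hb
  | tmul r g =>
    have : (CrossedProduct.tmul _ _ r g : TVG hn hℓ hζ)
        = CrossedProduct.tmul _ _ r 1 * gT hn hℓ hζ g := by
      rw [gT, CrossedProduct.tmul_mul_tmul, (alpha hn hℓ hζ).one_left]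
      simp
    rw [this, map_mul]
    exact tens r _ (ofGroup_mem g)

theorem Hecke.mem_center_of_commute {y : Hecke hn hℓ hζ t}
    (hx : ∀ i, Hecke.x hn hℓ hζ t i * y = y * Hecke.x hn hℓ hζ t i)
    (hg : ∀ h, Hecke.ofGroup hn hℓ hζ t h * y = y * Hecke.ofGroup hn hℓ hζ t h) :
    y ∈ Subalgebra.center ℂ (Hecke hn hℓ hζ t) := by
  rw [Subalgebra.mem_center_iff]
  intro b
  have := Hecke.submodule_eq_top hn hℓ hζ t
    (LinearMap.ker (LinearMap.mulRight ℂ y - LinearMap.mulLeft ℂ y)) (by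
      intro h
      simp [hg]) (by
      intro i b hb
      simp only [LinearMap.mem_ker, LinearMap.sub_apply, LinearMap.mulRight_apply,
        LinearMap.mulLeft_apply, sub_eq_zero] at hb ⊢
      rw [mul_assoc, hb, ← mul_assoc, hx, mul_assoc])
  have hb : b ∈ LinearMap.ker (LinearMap.mulRight ℂ y - LinearMap.mulLeft ℂ y) := by
    rw [this]; trivial
  simpa [sub_eq_zero] using hb

/-! ### The filtration by degree -/

/-- The product of the generators `x_i` along a list of indices. -/
def Hecke.xword (l : List (Fin n)) : Hecke hn hℓ hζ t := (l.map (Hecke.x hn hℓ hζ t)).prod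

theorem Hecke.xword_cons (i : Fin n) (l : List (Fin n)) :
    Hecke.xword hn hℓ hζ t (i :: l) = Hecke.x hn hℓ hζ t i * Hecke.xword hn hℓ hζ t l := by
  simp [Hecke.xword]

theorem Hecke.xword_nil : Hecke.xword hn hℓ hζ t [] = 1 := rfl

/-- The span of the elements `x_{i_1} ⋯ x_{i_k} g` with `k < d`. -/
def Hecke.filt (d : ℕ) : Submodule ℂ (Hecke hn hℓ hζ t) :=
  Submodule.span ℂ {y | ∃ (l : List (Fin n)) (h : diagGroup n ℓ), l.length < d ∧
    y = Hecke.xword hn hℓ hζ t l * Hecke.ofGroup hn hℓ hζ t h}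

theorem Hecke.xword_mul_mem_filt {d : ℕ} {l : List (Fin n)} (hl : l.length < d)
    (h : diagGroup n ℓ) :
    Hecke.xword hn hℓ hζ t l * Hecke.ofGroup hn hℓ hζ t h ∈ Hecke.filt hn hℓ hζ t d :=
  Submodule.subset_span ⟨l, h, hl, rfl⟩

theorem Hecke.filt_induction {d : ℕ} (N : Submodule ℂ (Hecke hn hℓ hζ t))
    (hN : ∀ (l : List (Fin n)) (h : diagGroup n ℓ), l.length < d →
      Hecke.xword hn hℓ hζ t l * Hecke.ofGroup hn hℓ hζ t h ∈ N) :
    Hecke.filt hn hℓ hζ t d ≤ N := by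
  rw [Hecke.filt, Submodule.span_le]
  rintro _ ⟨l, h, hl, rfl⟩
  exact hN l h hl

theorem Hecke.filt_mono {d e : ℕ} (h : d ≤ e) :
    Hecke.filt hn hℓ hζ t d ≤ Hecke.filt hn hℓ hζ t e :=
  Hecke.filt_induction hn hℓ hζ t _ fun _ k hl =>
    Hecke.xword_mul_mem_filt hn hℓ hζ t (hl.trans_le h) k

/-- The strict bound on the length leaves no words at level 0; this starts the degree induction and
yields injectivity. -/
theorem Hecke.filt_zero : Hecke.filt hn hℓ hζ t 0 = ⊥ := by
  rw [eq_bot_iff]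
  exact Hecke.filt_induction hn hℓ hζ t _ fun _ _ hl => absurd hl (by omega)

theorem Hecke.x_mul_mem_filt (i : Fin n) {d : ℕ} {y : Hecke hn hℓ hζ t}
    (hy : y ∈ Hecke.filt hn hℓ hζ t d) :
    Hecke.x hn hℓ hζ t i * y ∈ Hecke.filt hn hℓ hζ t (d + 1) := by
  refine Hecke.filt_induction hn hℓ hζ t ((Hecke.filt hn hℓ hζ t (d + 1)).comap
    (LinearMap.mulLeft ℂ (Hecke.x hn hℓ hζ t i))) ?_ hy
  intro l h hl
  rw [Submodule.mem_comap, LinearMap.mulLeft_apply, ← mul_assoc, ← Hecke.xword_cons]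
  exact Hecke.xword_mul_mem_filt hn hℓ hζ t (by simpa using hl) h

theorem Hecke.mul_ofGroup_mem_filt (g : diagGroup n ℓ) {d : ℕ} {y : Hecke hn hℓ hζ t}
    (hy : y ∈ Hecke.filt hn hℓ hζ t d) :
    y * Hecke.ofGroup hn hℓ hζ t g ∈ Hecke.filt hn hℓ hζ t d := by
  refine Hecke.filt_induction hn hℓ hζ t ((Hecke.filt hn hℓ hζ t d).comap
    (LinearMap.mulRight ℂ (Hecke.ofGroup hn hℓ hζ t g))) ?_ hy
  intro l h hl
  rw [Submodule.mem_comap, LinearMap.mulRight_apply, mul_assoc, Hecke.ofGroup_mul, mul_smul_comm]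
  exact Submodule.smul_mem _ _ (Hecke.xword_mul_mem_filt hn hℓ hζ t hl _)

theorem Hecke.ofGroup_mul_xword (g : diagGroup n ℓ) (l : List (Fin n)) : ∃ c : ℂ,
    Hecke.ofGroup hn hℓ hζ t g * Hecke.xword hn hℓ hζ t l
      = c • (Hecke.xword hn hℓ hζ t l * Hecke.ofGroup hn hℓ hζ t g) := by
  induction l with
  | nil => exact ⟨1, by simp [Hecke.xword_nil]⟩
  | cons i l ih =>
    obtain ⟨c, hc⟩ := ih
    refine ⟨entry i g * c, ?_⟩
    rw [Hecke.xword_cons, ← mul_assoc, Hecke.ofGroup_mul_x, smul_mul_assoc, mul_assoc, hc,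
      mul_smul_comm, smul_smul, mul_assoc]

/-- A transposition of neighbouring letters replaces them by a multiple of a group element, which
moves to the right end of the word up to a scalar. -/
theorem Hecke.xword_sub_mem_filt {l l' : List (Fin n)} (h : l.Perm l') :
    Hecke.xword hn hℓ hζ t l - Hecke.xword hn hℓ hζ t l' ∈ Hecke.filt hn hℓ hζ t l.length := by
  induction h with
  | nil => simp
  | cons i h ih =>
    rw [Hecke.xword_cons, Hecke.xword_cons, ← mul_sub]
    exact Hecke.x_mul_mem_filt hn hℓ hζ t i ih
  | swap i j l =>
    obtain ⟨c, g, hc⟩ := Hecke.x_commutator hn hℓ hζ t j i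
    obtain ⟨e, he⟩ := Hecke.ofGroup_mul_xword hn hℓ hζ t g l
    simp only [Hecke.xword_cons, ← mul_assoc]
    rw [← sub_mul, hc, smul_mul_assoc, he]
    refine Submodule.smul_mem _ _ (Submodule.smul_mem _ _ ?_)
    exact Hecke.xword_mul_mem_filt hn hℓ hζ t (by simp) g
  | trans h1 _ ih1 ih2 =>
    rw [← sub_add_sub_cancel]
    rw [← h1.length_eq] at ih2
    exact Submodule.add_mem _ ih1 ih2

theorem Hecke.exists_mem_filt (y : Hecke hn hℓ hζ t) : ∃ d, y ∈ Hecke.filt hn hℓ hζ t d := by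
  have htop := Hecke.submodule_eq_top hn hℓ hζ t (⨆ d, Hecke.filt hn hℓ hζ t d)
    (fun h => Submodule.mem_iSup_of_mem 1 (by
      simpa [Hecke.xword_nil] using
        Hecke.xword_mul_mem_filt hn hℓ hζ t (d := 1) (l := []) (by simp) h))
    (fun i y hy => by
      have hdir : Directed (· ≤ ·) (Hecke.filt hn hℓ hζ t) :=
        Monotone.directed_le fun _ _ h => Hecke.filt_mono hn hℓ hζ t h
      rw [Submodule.mem_iSup_of_directed _ hdir] at hy
      obtain ⟨d, hd⟩ := hy
      exact Submodule.mem_iSup_of_mem (d + 1) (Hecke.x_mul_mem_filt hn hℓ hζ t i hd))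
  have hy : y ∈ ⨆ d, Hecke.filt hn hℓ hζ t d := by rw [htop]; trivial
  rwa [Submodule.mem_iSup_of_directed _
    (Monotone.directed_le fun _ _ h => Hecke.filt_mono hn hℓ hζ t h)] at hy

/-! ### Degree in the quantum torus and injectivity of `toTorus`. -/

/-- The elements of the quantum torus of total degree less than `d` in the `z_i`. -/
def degLT (d : ℤ) : Submodule ℂ (Torus hn hℓ hζ) :=
  ⨅ (p : Fin n → ℤ) (g : diagGroup n ℓ) (_ : d ≤ ∑ j, p j), LinearMap.ker (coeff hn hℓ hζ p g)

theorem mem_degLT {d : ℤ} {f : Torus hn hℓ hζ} : f ∈ degLT hn hℓ hζ d ↔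
    ∀ p g, d ≤ ∑ j, p j → coeff hn hℓ hζ p g f = 0 := by
  simp [degLT]

theorem degLT_mono {d e : ℤ} (h : d ≤ e) : degLT hn hℓ hζ d ≤ degLT hn hℓ hζ e := by
  intro f hf
  rw [mem_degLT] at hf ⊢
  exact fun p g hp => hf p g (h.trans hp)

theorem mono_mem_degLT {d : ℤ} {p : Fin n → ℤ} (hp : ∑ j, p j < d) (g : diagGroup n ℓ) :
    mono hn hℓ hζ p g ∈ degLT hn hℓ hζ d := by
  classical
  rw [mem_degLT]
  intro q h hq
  rw [coeff_mono, if_neg]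
  rintro ⟨rfl, -⟩
  omega

theorem mono_mul_mem_degLT {d e : ℤ} {p : Fin n → ℤ} (hp : ∑ j, p j + d ≤ e) (g : diagGroup n ℓ)
    {f : Torus hn hℓ hζ} (hf : f ∈ degLT hn hℓ hζ d) :
    mono hn hℓ hζ p g * f ∈ degLT hn hℓ hζ e := by
  rw [mem_degLT] at hf ⊢
  intro q h hq
  have := coeff_mono_mul hn hℓ hζ p (q - p) g (g⁻¹ * h) f
  rw [add_sub_cancel, mul_inv_cancel_left] at this
  rw [this, hf, mul_zero]
  simp only [Pi.sub_apply, Finset.sum_sub_distrib]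
  omega

theorem mul_mono_mem_degLT {d e : ℤ} {p : Fin n → ℤ} (hp : ∑ j, p j + d ≤ e) (g : diagGroup n ℓ)
    {f : Torus hn hℓ hζ} (hf : f ∈ degLT hn hℓ hζ d) :
    f * mono hn hℓ hζ p g ∈ degLT hn hℓ hζ e := by
  rw [mem_degLT] at hf ⊢
  intro q h hq
  have := coeff_mul_mono hn hℓ hζ (q - p) p (h * g⁻¹) g f
  rw [sub_add_cancel, inv_mul_cancel_right] at this
  rw [this, hf, mul_zero]
  simp only [Pi.sub_apply, Finset.sum_sub_distrib]
  omega

theorem sum_single_one {m : ℕ} (i : Fin m) : ∑ j, (Pi.single i 1 : Fin m → ℤ) j = 1 := by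
  simp

theorem bL_mul_mem_degLT (i : Fin n) {d : ℤ} {f : Torus hn hℓ hζ} (hf : f ∈ degLT hn hℓ hζ d) :
    bL hn hℓ hζ t i * f ∈ degLT hn hℓ hζ (d - 1) := by
  rw [bL, smul_mul_assoc]
  refine Submodule.smul_mem _ _ (mono_mul_mem_degLT hn hℓ hζ ?_ _ hf)
  simp [add_comm, sub_eq_add_neg]

theorem mul_bL_mem_degLT (i : Fin n) {d : ℤ} {f : Torus hn hℓ hζ} (hf : f ∈ degLT hn hℓ hζ d) :
    f * bL hn hℓ hζ t i ∈ degLT hn hℓ hζ (d - 1) := by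
  rw [bL, mul_smul_comm]
  refine Submodule.smul_mem _ _ (mul_mono_mem_degLT hn hℓ hζ ?_ _ hf)
  simp [add_comm, sub_eq_add_neg]

theorem sum_count {m : ℕ} (l : List (Fin m)) : ∑ i, (l.count i : ℤ) = l.length := by
  rw [← Nat.cast_sum]
  congr 1
  simpa using Multiset.sum_count_eq_card (s := Finset.univ) (m := (l : Multiset (Fin m))) (by simp)

/-- As b_i has degree -1, only the choice of z_i in every factor z_i + b_i reaches top degree. -/
theorem toTorus_xword_sub_mem (l : List (Fin n)) (h : diagGroup n ℓ) :
    toTorus hn hℓ hζ t (Hecke.xword hn hℓ hζ t l * Hecke.ofGroup hn hℓ hζ t h)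
      - mono hn hℓ hζ (fun i => l.count i) h ∈ degLT hn hℓ hζ l.length := by
  induction l with
  | nil =>
    rw [Hecke.xword_nil, one_mul, toTorus_ofGroup, gL]
    convert Submodule.zero_mem _
    rw [sub_eq_zero]
    simp
    rfl
  | cons i l ih =>
    rw [Hecke.xword_cons, mul_assoc, map_mul, toTorus_x, xL, add_mul]
    set y := toTorus hn hℓ hζ t (Hecke.xword hn hℓ hζ t l * Hecke.ofGroup hn hℓ hζ t h) with hy
    have h1 : mono hn hℓ hζ (fun j => ((i :: l).count j : ℤ)) h
        = zL hn hℓ hζ i * mono hn hℓ hζ (fun j => (l.count j : ℤ)) h := by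
      rw [zL, mono_mul, alphaFun_one_left, weight_one, mul_one, Units.val_one, one_smul, one_mul]
      congr 1
      ext j
      rw [List.count_cons, Pi.add_apply, Pi.single_apply]
      by_cases hij : j = i
      · subst hij
        simp [add_comm]
      · simp [hij, Ne.symm hij]
    have hydeg : y ∈ degLT hn hℓ hζ (l.length + 1) := by
      rw [← sub_add_cancel y (mono hn hℓ hζ (fun i => (l.count i : ℤ)) h)]
      refine Submodule.add_mem _ (degLT_mono hn hℓ hζ (by omega) ih)
        (mono_mem_degLT hn hℓ hζ ?_ h)
      rw [sum_count]
      omega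
    rw [h1, add_sub_right_comm, ← mul_sub]
    refine Submodule.add_mem _ (mono_mul_mem_degLT hn hℓ hζ ?_ 1 ih) ?_
    · rw [sum_single_one, List.length_cons]
      push_cast
      omega
    · refine degLT_mono hn hℓ hζ ?_ (bL_mul_mem_degLT hn hℓ hζ t i hydeg)
      rw [List.length_cons]
      push_cast
      omega

theorem toTorus_mem_degLT {d : ℕ} {y : Hecke hn hℓ hζ t} (hy : y ∈ Hecke.filt hn hℓ hζ t d) :
    toTorus hn hℓ hζ t y ∈ degLT hn hℓ hζ d := by
  refine Hecke.filt_induction hn hℓ hζ t ((degLT hn hℓ hζ d).comap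
    (toTorus hn hℓ hζ t).toLinearMap) ?_ hy
  intro l h hl
  rw [Submodule.mem_comap, AlgHom.toLinearMap_apply,
    ← sub_add_cancel (toTorus hn hℓ hζ t _) (mono hn hℓ hζ (fun i => (l.count i : ℤ)) h)]
  refine Submodule.add_mem _
    (degLT_mono hn hℓ hζ (by omega) (toTorus_xword_sub_mem hn hℓ hζ t l h))
    (mono_mem_degLT hn hℓ hζ ?_ h)
  rw [sum_count]
  omega

open Classical in
theorem coeff_toTorus_xword {l : List (Fin n)} {p : Fin n → ℤ} (hp : (l.length : ℤ) ≤ ∑ j, p j)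
    (g h : diagGroup n ℓ) :
    coeff hn hℓ hζ p g
        (toTorus hn hℓ hζ t (Hecke.xword hn hℓ hζ t l * Hecke.ofGroup hn hℓ hζ t h))
      = if (fun i => (l.count i : ℤ)) = p ∧ h = g then 1 else 0 := by
  have := (mem_degLT hn hℓ hζ).1 (toTorus_xword_sub_mem hn hℓ hζ t l h) p g hp
  rwa [map_sub, sub_eq_zero, coeff_mono] at this

/-- Laurent monomials with negative exponents do occur in images, but in top degree the exponents
count the letters of a word. -/
theorem exists_nat_exponent {d : ℕ} {y : Hecke hn hℓ hζ t}
    (hy : y ∈ Hecke.filt hn hℓ hζ t (d + 1)) {p : Fin n → ℤ} {g : diagGroup n ℓ}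
    (hp : ∑ j, p j = d) (hc : coeff hn hℓ hζ p g (toTorus hn hℓ hζ t y) ≠ 0) (i : Fin n) :
    0 ≤ p i := by
  classical
  by_contra hneg
  apply hc
  refine Hecke.filt_induction hn hℓ hζ t (LinearMap.ker ((coeff hn hℓ hζ p g).comp
    (toTorus hn hℓ hζ t).toLinearMap)) ?_ hy
  intro l h hl
  rw [LinearMap.mem_ker, LinearMap.comp_apply, AlgHom.toLinearMap_apply,
    coeff_toTorus_xword hn hℓ hζ t (by omega), if_neg]
  rintro ⟨rfl, -⟩
  simp at hneg

instance diagGroup_finite [NeZero ℓ] : Finite (diagGroup n ℓ) := by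
  refine Finite.of_injective
    (fun (g : diagGroup n ℓ) (j : Fin n) => (⟨entry j g, entry_pow j g⟩ : rootsOfUnity ℓ ℂ)) ?_
  intro g h hgh
  exact eq_of_entry_eq fun j => congrArg Subtype.val (congrFun hgh j)

/-- A list of indices in which every `i` occurs `p i` times. -/
def stdList {m : ℕ} (p : Fin m → ℕ) : List (Fin m) :=
  (∑ i, p i • ({i} : Multiset (Fin m))).toList

theorem count_stdList {m : ℕ} (p : Fin m → ℕ) (i : Fin m) : (stdList p).count i = p i := by
  rw [stdList, ← Multiset.coe_count, Multiset.coe_toList, Multiset.count_sum']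
  simp [Multiset.count_nsmul, Multiset.count_singleton]

open Classical in
/-- Modulo lower degree, an element is determined by the leading coefficients of its image. -/
theorem sub_sum_coeff_mem_filt [Fintype (diagGroup n ℓ)] {d : ℕ} {y : Hecke hn hℓ hζ t}
    (hy : y ∈ Hecke.filt hn hℓ hζ t (d + 1)) :
    y - ∑ p ∈ Finset.piAntidiag Finset.univ d, ∑ g : diagGroup n ℓ,
      coeff hn hℓ hζ (fun i => (p i : ℤ)) g (toTorus hn hℓ hζ t y) •
        (Hecke.xword hn hℓ hζ t (stdList p) * Hecke.ofGroup hn hℓ hζ t g)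
      ∈ Hecke.filt hn hℓ hζ t d := by
  -- The expression is linear in y, so it suffices to test it on words.
  let A : Hecke hn hℓ hζ t →ₗ[ℂ] Hecke hn hℓ hζ t := LinearMap.id -
    ∑ p ∈ Finset.piAntidiag Finset.univ d, ∑ g : diagGroup n ℓ,
      LinearMap.smulRight ((coeff hn hℓ hζ (fun i => (p i : ℤ)) g).comp
        (toTorus hn hℓ hζ t).toLinearMap)
        (Hecke.xword hn hℓ hζ t (stdList p) * Hecke.ofGroup hn hℓ hζ t g)
  suffices h : y ∈ (Hecke.filt hn hℓ hζ t d).comap A by simpa [A] using h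
  refine Hecke.filt_induction hn hℓ hζ t _ ?_ hy
  intro l h hl
  suffices H : Hecke.xword hn hℓ hζ t l * Hecke.ofGroup hn hℓ hζ t h -
      ∑ p ∈ Finset.piAntidiag Finset.univ d, ∑ g : diagGroup n ℓ,
      (if (fun i => (l.count i : ℤ)) = (fun i => (p i : ℤ)) ∧ h = g then (1 : ℂ) else 0) •
        (Hecke.xword hn hℓ hζ t (stdList p) * Hecke.ofGroup hn hℓ hζ t g)
      ∈ Hecke.filt hn hℓ hζ t d by
    rw [Submodule.mem_comap]
    convert H using 1
    simp only [A, LinearMap.sub_apply, LinearMap.id_apply, LinearMap.sum_apply,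
      LinearMap.smulRight_apply, LinearMap.comp_apply, AlgHom.toLinearMap_apply]
    congr 1
    refine Finset.sum_congr rfl fun p hp => Finset.sum_congr rfl fun g _ => ?_
    rw [coeff_toTorus_xword]
    rw [← Nat.cast_sum, (Finset.mem_piAntidiag.1 hp).1]
    omega
  have hsum : ∑ i, l.count i = l.length := by exact_mod_cast sum_count l
  rcases Nat.lt_or_ge l.length d with hlt | hge
  · rw [Finset.sum_eq_zero, sub_zero]
    · exact Hecke.xword_mul_mem_filt hn hℓ hζ t hlt h
    · intro p hp
      refine Finset.sum_eq_zero fun g _ => ?_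
      rw [if_neg, zero_smul]
      rintro ⟨hp', -⟩
      have hp'' : (fun i => l.count i) = p := by
        ext i
        exact_mod_cast congrFun hp' i
      rw [← hp'', Finset.mem_piAntidiag, hsum] at hp
      omega
  · have hld : l.length = d := by omega
    rw [Finset.sum_eq_single (fun i => l.count i), Finset.sum_eq_single h]
    · rw [if_pos ⟨rfl, rfl⟩, one_smul, ← sub_mul, ← hld]
      -- The order of the letters in `stdList` is unspecified, which is harmless modulo lower
      -- degree.
      refine Hecke.mul_ofGroup_mem_filt hn hℓ hζ t h (Hecke.xword_sub_mem_filt hn hℓ hζ t ?_)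
      rw [List.perm_iff_count]
      intro i
      rw [count_stdList]
    · intro g _ hg
      rw [if_neg, zero_smul]
      exact fun H => hg H.2.symm
    · simp
    · intro p _ hp
      refine Finset.sum_eq_zero fun g _ => ?_
      rw [if_neg, zero_smul]
      rintro ⟨hp', -⟩
      apply hp
      ext i
      exact_mod_cast (congrFun hp' i).symm
    · intro H
      exact absurd (Finset.mem_piAntidiag.2 ⟨hsum.trans hld, by simp⟩) H

/-- Some level of the filtration contains y. As long as that level exceeds d, the leading
coefficients of the image vanish, so `sub_sum_coeff_mem_filt` lowers it by one. -/
theorem mem_filt_of_toTorus_mem_degLT {d : ℕ} {y : Hecke hn hℓ hζ t}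
    (hy : toTorus hn hℓ hζ t y ∈ degLT hn hℓ hζ d) : y ∈ Hecke.filt hn hℓ hζ t d := by
  have : NeZero ℓ := ⟨by omega⟩
  have := Fintype.ofFinite (diagGroup n ℓ)
  classical
  have descend : ∀ k, y ∈ Hecke.filt hn hℓ hζ t (d + k) → y ∈ Hecke.filt hn hℓ hζ t d := by
    intro k
    induction k with
    | zero => exact id
    | succ k ih =>
      intro h
      apply ih
      have h' := sub_sum_coeff_mem_filt hn hℓ hζ t (d := d + k) h
      rwa [Finset.sum_eq_zero, sub_zero] at h'
      intro p hp
      refine Finset.sum_eq_zero fun g _ => ?_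
      rw [(mem_degLT hn hℓ hζ).1 hy, zero_smul]
      rw [← Nat.cast_sum, (Finset.mem_piAntidiag.1 hp).1]
      omega
  obtain ⟨e, he⟩ := Hecke.exists_mem_filt hn hℓ hζ t y
  exact descend e (Hecke.filt_mono hn hℓ hζ t (by omega) he)

theorem toTorus_injective : Function.Injective (toTorus hn hℓ hζ t) := by
  rw [injective_iff_map_eq_zero]
  intro y hy
  have := mem_filt_of_toTorus_mem_degLT hn hℓ hζ t (d := 0) (y := y)
    (by rw [hy]; exact Submodule.zero_mem _)
  rwa [Hecke.filt_zero, Submodule.mem_bot] at this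

end Filtration

/-! ### Ordered products -/

section OrderedProducts

variable {M : Type*} [Monoid M]

theorem commute_ofFn_prod {k : ℕ} {c : M} {m : Fin k → M} (h : ∀ j, Commute c (m j)) :
    Commute c (List.ofFn m).prod := by
  refine Commute.list_prod_right _ _ fun x hx => ?_
  obtain ⟨j, rfl⟩ := List.mem_ofFn.1 hx
  exact h j

/-- Each q i only has to move left past the p j with j > i. This puts the group elements of a
summand of w into their positions. -/
theorem ofFn_prod_mul_ofFn_prod {k : ℕ} (p q : Fin k → M)
    (h : ∀ i j, i < j → Commute (q i) (p j)) :
    (List.ofFn p).prod * (List.ofFn q).prod = (List.ofFn fun j => p j * q j).prod := by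
  induction k with
  | zero => simp
  | succ k ih =>
    simp only [List.ofFn_succ, List.prod_cons]
    rw [← ih (fun j => p j.succ) (fun j => q j.succ)
      fun i j hij => h _ _ (Fin.succ_lt_succ_iff.2 hij)]
    have := (commute_ofFn_prod (m := fun j : Fin k => p j.succ) (c := q 0)
      fun j => h _ _ (Fin.succ_pos j)).eq
    simp only [mul_assoc]
    rw [← mul_assoc (List.ofFn _).prod (q 0), ← this]
    simp only [mul_assoc]

theorem sort_map_prod {k : ℕ} (S : Finset (Fin k)) (f : Fin k → M) :
    ((S.sort (· ≤ ·)).map f).prod = (List.ofFn fun j => if j ∈ S then f j else 1).prod := by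
  have h : S.sort (· ≤ ·) = (List.finRange k).filter (· ∈ S) := by
    refine List.Perm.eq_of_pairwise' (r := (· ≤ ·)) (Finset.pairwise_sort _ _)
      ((List.pairwise_le_finRange k).filter _) ?_
    rw [List.perm_ext_iff_of_nodup (Finset.sort_nodup _ _) ((List.nodup_finRange k).filter _)]
    simp
  rw [h, List.ofFn_eq_map]
  generalize List.finRange k = l
  induction l with
  | nil => rfl
  | cons a l ih =>
    by_cases ha : a ∈ S
    · simp [ha, ih]
    · simp [ha, ih]

/-- Two ordered products whose factors differ only at two consecutive positions. -/
theorem ofFn_prod_consecutive {k : ℕ} (m m' : Fin k → M) (i : ℕ) (hi : i + 1 < k)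
    (h : ∀ j : Fin k, j.val ≠ i → j.val ≠ i + 1 → m j = m' j) : ∃ a b : M,
    (List.ofFn m).prod = a * (m ⟨i, by omega⟩ * m ⟨i + 1, hi⟩) * b ∧
      (List.ofFn m').prod = a * (m' ⟨i, by omega⟩ * m' ⟨i + 1, hi⟩) * b := by
  induction i generalizing k with
  | zero =>
    obtain ⟨k, rfl⟩ : ∃ r, k = r + 2 := ⟨k - 2, by omega⟩
    refine ⟨1, (List.ofFn fun j : Fin k => m j.succ.succ).prod, ?_, ?_⟩
    · simp [List.ofFn_succ, mul_assoc]
    · have : (fun j : Fin k => m j.succ.succ) = fun j => m' j.succ.succ := by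
        ext j
        exact h _ (by simp) (by simp)
      rw [this]
      simp [List.ofFn_succ, mul_assoc]
  | succ i ih =>
    obtain ⟨k, rfl⟩ : ∃ r, k = r + 1 := ⟨k - 1, by omega⟩
    obtain ⟨a, b, h1, h2⟩ := ih (fun j => m j.succ) (fun j => m' j.succ) (by omega)
      (fun j hj hj' => h _ (by simpa using hj) (by simpa using hj'))
    refine ⟨m 0 * a, b, ?_, ?_⟩
    · rw [List.ofFn_succ, List.prod_cons, h1]
      simp [mul_assoc]
    · rw [List.ofFn_succ, List.prod_cons, h2, h 0 (by simp) (by simp)]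
      simp [mul_assoc]

/-- Two ordered products whose factors differ only at the first and at the last position. -/
theorem ofFn_prod_ends {k : ℕ} (hk : 2 ≤ k) (m m' : Fin k → M)
    (h : ∀ j : Fin k, j.val ≠ 0 → j.val ≠ k - 1 → m j = m' j) : ∃ a : M,
    (∀ c, (∀ j : Fin k, j.val ≠ 0 → j.val ≠ k - 1 → Commute c (m j)) → Commute c a) ∧
    (List.ofFn m).prod = m ⟨0, by omega⟩ * a * m ⟨k - 1, by omega⟩ ∧
      (List.ofFn m').prod = m' ⟨0, by omega⟩ * a * m' ⟨k - 1, by omega⟩ := by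
  obtain ⟨k, rfl⟩ : ∃ r, k = r + 2 := ⟨k - 2, by omega⟩
  have hlast : (⟨k + 2 - 1, by omega⟩ : Fin (k + 2)) = (Fin.last k).succ := by
    ext
    simp
  refine ⟨(List.ofFn fun j : Fin k => m j.castSucc.succ).prod, ?_, ?_, ?_⟩
  · intro c hc
    refine commute_ofFn_prod fun j => hc _ (by simp) ?_
    have := j.2
    simp
    omega
  · rw [hlast, List.ofFn_succ, List.prod_cons, List.ofFn_succ', List.prod_concat, mul_assoc]
    rfl
  · have : (fun j : Fin k => m j.castSucc.succ) = fun j => m' j.castSucc.succ := by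
      ext j
      refine h _ (by simp) ?_
      have := j.2
      simp
      omega
    rw [this, hlast, List.ofFn_succ, List.prod_cons, List.ofFn_succ', List.prod_concat, mul_assoc]
    rfl

end OrderedProducts

/-! ### The products of all z_i and of all b_i. -/

section Central

variable {n ℓ : ℕ} [NeZero n] (hn : 3 ≤ n) (hℓ : 2 ≤ ℓ) {ζ : ℂ} (hζ : IsPrimitiveRoot ζ ℓ)
  (t : Fin n → ℂ)

theorem ofFn_mono_one_prod {k : ℕ} (p : Fin k → Fin n → ℤ) :
    (List.ofFn fun j => mono hn hℓ hζ (p j) 1).prod = mono hn hℓ hζ (∑ j, p j) 1 := by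
  induction k with
  | zero => rfl
  | succ k ih =>
    rw [List.ofFn_succ, List.prod_cons, ih, Fin.sum_univ_succ, mono_mul]
    simp [alphaFun_one_left]

theorem ofFn_smul_mono_prod {k : ℕ} (c : Fin k → ℂ) (p : Fin k → Fin n → ℤ)
    (g : Fin k → diagGroup n ℓ) : ∃ e : ℂ,
    (List.ofFn fun j => c j • mono hn hℓ hζ (p j) (g j)).prod
      = e • mono hn hℓ hζ (∑ j, p j) (∏ j, g j) := by
  induction k with
  | zero => exact ⟨1, (one_smul _ _).symm⟩
  | succ k ih =>
    obtain ⟨e, he⟩ := ih (fun j => c j.succ) (fun j => p j.succ) (fun j => g j.succ)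
    rw [List.ofFn_succ, List.prod_cons, he, Fin.sum_univ_succ, Fin.prod_univ_succ,
      smul_mul_smul_comm, mono_mul, smul_smul]
    exact ⟨_, rfl⟩

theorem zL_prod : (List.ofFn (zL hn hℓ hζ)).prod = mono hn hℓ hζ (fun _ => 1) 1 := by
  refine (ofFn_mono_one_prod hn hℓ hζ _).trans ?_
  congr 1
  ext j
  simp [Finset.sum_apply, Pi.single_apply]

/-- The group parts multiply to 1 by `prod_gen`. The scalar stays unspecified because only
centrality and degree of the product matter. -/
theorem bL_prod : ∃ e : ℂ,
    (List.ofFn (bL hn hℓ hζ t)).prod = e • mono hn hℓ hζ (fun _ => -1) 1 := by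
  obtain ⟨e, he⟩ := ofFn_smul_mono_prod hn hℓ hζ (fun i => - sigma ζ t (i - 1))
    (fun i => - Pi.single (i - 1) 1) (fun i => gen hn hℓ hζ (i - 1))
  refine ⟨e, he.trans ?_⟩
  congr 2
  · have := (Equiv.subRight (1 : Fin n)).sum_comp (fun i => (Pi.single i 1 : Fin n → ℤ))
    simp only [Equiv.subRight_apply] at this
    rw [Finset.sum_neg_distrib, this]
    ext j
    simp [Finset.sum_apply, Pi.single_apply]
  · rw [← prod_gen hn hℓ hζ]
    exact (Equiv.subRight (1 : Fin n)).prod_comp (fun i => gen hn hℓ hζ i)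

/-! ### The image of `w` -/

theorem mem_nonadjacentSets {S : Finset (Fin n)} :
    S ∈ nonadjacentSets n ↔ ∀ i ∈ S, i + 1 ∉ S := by
  simp only [nonadjacentSets, Finset.mem_filter, Finset.mem_univ, true_and]
  constructor
  · intro h i hi hi'
    exact h i hi _ hi' (Or.inl rfl)
  · rintro h i hi j hj (rfl | rfl)
    · exact h i hi hj
    · exact h j hj hi

/-- The first of the two alternatives for the `j`-th factor of the summand of `w` at `S`. -/
def factorA (S : Finset (Fin n)) (j : Fin n) : Torus hn hℓ hζ :=
  if j ∈ S then tau ζ t j • gL hn hℓ hζ (gen hn hℓ hζ j)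
  else if j - 1 ∈ S then 0 else zL hn hℓ hζ j

/-- The second of the two alternatives for the `j`-th factor of the summand of `w` at `S`. -/
def factorB (S : Finset (Fin n)) (j : Fin n) : Torus hn hℓ hζ :=
  if j ∈ S then 0 else if j - 1 ∈ S then 1 else bL hn hℓ hζ t j

theorem exponent_apply (S : Finset (Fin n)) (j : Fin n) :
    (delta n - ∑ i ∈ S, eps i) j
      = 1 - ((if j ∈ S then 1 else 0) + (if j - 1 ∈ S then 1 else 0)) := by
  rw [Pi.sub_apply, delta]
  congr 1
  simp only [Finset.sum_apply, eps, Pi.add_apply, Finset.sum_add_distrib, Pi.single_apply]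
  simp [← sub_eq_iff_eq_add]

theorem gL_gen_commute_xL {i j : Fin n} (h : j ≠ i) (h' : j ≠ i + 1) :
    Commute (gL hn hℓ hζ (gen hn hℓ hζ i)) (xL hn hℓ hζ t j) := by
  have := gL_mul_xL hn hℓ hζ t (gen hn hℓ hζ i) j
  rwa [entry_gen, genEntry, if_neg h, if_neg h', one_smul] at this

/-- A summand of `w`, with the group elements moved to their positions. -/
theorem toTorus_summand {S : Finset (Fin n)} (hS : S ∈ nonadjacentSets n) :
    toTorus hn hℓ hζ t ((∏ i ∈ S, tau ζ t i) •
      (Hecke.xpow hn hℓ hζ t (delta n - ∑ i ∈ S, eps i) *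
        ((S.sort (· ≤ ·)).map (Hecke.g hn hℓ hζ t)).prod))
      = (List.ofFn (factorA hn hℓ hζ t S + factorB hn hℓ hζ t S)).prod := by
  rw [mem_nonadjacentSets] at hS
  have hx : toTorus hn hℓ hζ t (Hecke.xpow hn hℓ hζ t (delta n - ∑ i ∈ S, eps i))
      = (List.ofFn fun j => if j ∈ S ∨ j - 1 ∈ S then 1 else xL hn hℓ hζ t j).prod := by
    rw [Hecke.xpow, map_list_prod, List.map_ofFn]
    congr 2
    ext1 j
    rw [Function.comp_apply, map_pow, toTorus_x, exponent_apply]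
    by_cases h1 : j ∈ S
    · have h2 : j - 1 ∉ S := fun h => hS _ h (by simpa using h1)
      simp [h1, h2]
    · by_cases h2 : j - 1 ∈ S
      · simp [h1, h2]
      · simp [h1, h2]
  have hg : toTorus hn hℓ hζ t ((S.sort (· ≤ ·)).map (Hecke.g hn hℓ hζ t)).prod
      = (List.ofFn fun j => if j ∈ S then gL hn hℓ hζ (gen hn hℓ hζ j) else 1).prod := by
    rw [map_list_prod, List.map_map, ← sort_map_prod]
    congr 2
    ext1 j
    exact toTorus_ofGroup hn hℓ hζ t _
  rw [map_smul, map_mul, hx, hg, ofFn_prod_mul_ofFn_prod]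
  · have hprod : ∏ i ∈ S, tau ζ t i = ∏ i, if i ∈ S then tau ζ t i else 1 := by
      rw [Finset.prod_ite_mem, Finset.univ_inter]
    rw [hprod]
    refine (MultilinearMap.map_smul_univ
      (MultilinearMap.mkPiAlgebraFin ℂ n (Torus hn hℓ hζ)) _ _).symm.trans ?_
    rw [MultilinearMap.mkPiAlgebraFin_apply]
    congr 2
    ext1 j
    rw [Pi.add_apply, factorA, factorB]
    by_cases h1 : j ∈ S
    · simp [h1]
    · by_cases h2 : j - 1 ∈ S
      · simp [h1, h2]
      · simp [h1, h2, xL]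
  -- g_i fails to commute with x_j only for j = i and j = i + 1, and for i ∈ S these two variables
  -- are absent from the monomial.
  · intro i j hij
    by_cases hi : i ∈ S
    · by_cases hj : j ∈ S ∨ j - 1 ∈ S
      · rw [if_pos hj]
        exact Commute.one_right _
      · rw [if_pos hi, if_neg hj]
        push Not at hj
        refine gL_gen_commute_xL hn hℓ hζ t (fun h => hj.1 (h ▸ hi)) (fun h => hj.2 ?_)
        rw [h]
        simpa using hi
    · rw [if_neg hi]
      exact Commute.one_left _

/-! ### Cancellation of the mixed terms of w. -/

/-- The positions `j ∈ T` with `j + 1 ∉ T`. -/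
def descents (T : Finset (Fin n)) : Finset (Fin n) := T.filter fun j => j + 1 ∉ T

theorem mem_descents {T : Finset (Fin n)} {j : Fin n} : j ∈ descents T ↔ j ∈ T ∧ j + 1 ∉ T := by
  simp [descents]

theorem mem_nonadjacentSets_of_subset_descents {S T : Finset (Fin n)} (h : S ⊆ descents T) :
    S ∈ nonadjacentSets n := by
  rw [mem_nonadjacentSets]
  intro i hi hi'
  exact (mem_descents.1 (h hi)).2 (mem_descents.1 (h hi')).1

/-- Take j ∈ S that is not a descent of T. Either j and j + 1 both lie in T and the factor at j + 1
is 0, or j ∉ T and the factor at j is 0. -/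
theorem piecewise_prod_eq_zero {S T : Finset (Fin n)} (hS : S ∈ nonadjacentSets n)
    (hST : ¬ S ⊆ descents T) :
    (List.ofFn (T.piecewise (factorA hn hℓ hζ t S) (factorB hn hℓ hζ t S))).prod = 0 := by
  rw [mem_nonadjacentSets] at hS
  obtain ⟨j, hj, hjT⟩ := Finset.not_subset.1 hST
  have key : ∀ i, T.piecewise (factorA hn hℓ hζ t S) (factorB hn hℓ hζ t S) i = 0 →
      (List.ofFn (T.piecewise (factorA hn hℓ hζ t S) (factorB hn hℓ hζ t S))).prod = 0 :=
    fun i hi => List.prod_eq_zero (List.mem_ofFn.2 ⟨i, hi⟩)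
  by_cases h : j ∈ T
  · apply key (j + 1)
    have h' : j + 1 ∈ T := by
      by_contra h'
      exact hjT (mem_descents.2 ⟨h, h'⟩)
    rw [Finset.piecewise_eq_of_mem _ _ _ h', factorA, if_neg (hS j hj), if_pos (by simpa using hj)]
  · apply key j
    rw [Finset.piecewise_eq_of_notMem _ _ _ h, factorB, if_pos hj]

theorem genEntry_last {i j : Fin n} (hi : i + 1 = 0) (hj : j.val ≠ 0) (hj' : j.val ≠ n - 1) :
    genEntry ζ i j = 1 ∧ genEntry ζ j 0 = 1 := by
  have h0 : j ≠ 0 := fun h => hj (by simp [h])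
  have hlast : ∀ k : Fin n, k + 1 = 0 → k.val = n - 1 := by
    intro k hk
    have := congrArg Fin.val hk
    have h1 : 1 % n = 1 ∨ n = 1 := by
      rcases Nat.lt_or_ge 1 n with h | h
      · exact Or.inl (Nat.mod_eq_of_lt h)
      · have := NeZero.ne n
        right; omega
    rw [Fin.val_add, Fin.val_one', Fin.val_zero] at this
    have hk2 := k.2
    rcases h1 with h1 | h1
    · rw [h1] at this
      by_contra hne
      rw [Nat.mod_eq_of_lt (by omega)] at this
      omega
    · omega
  constructor
  · rw [genEntry, if_neg, if_neg]
    · rwa [hi]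
    · rintro rfl
      exact hj' (hlast _ hi)
  · rw [genEntry, if_neg h0.symm, if_neg]
    intro h
    exact hj' (hlast _ h.symm)

/-- The factor `b_0` commutes with every factor at an interior position. -/
theorem bL_zero_commute (S T : Finset (Fin n)) {j : Fin n} (hj : j.val ≠ 0)
    (hj' : j.val ≠ n - 1) : Commute (bL hn hℓ hζ t 0)
      (T.piecewise (factorA hn hℓ hζ t S) (factorB hn hℓ hζ t S) j) := by
  obtain ⟨e1, e2⟩ := genEntry_last (ζ := ζ) (i := (0 : Fin n) - 1) (by simp) hj hj'
  have hz : Commute (bL hn hℓ hζ t 0) (zL hn hℓ hζ j) := by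
    have := bL_mul_zL hn hℓ hζ t 0 j
    rwa [e1, one_smul] at this
  have hg : Commute (bL hn hℓ hζ t 0) (gL hn hℓ hζ (gen hn hℓ hζ j)) := by
    have := gL_mul_bL hn hℓ hζ t (gen hn hℓ hζ j) 0
    rw [entry_gen, e2, one_smul] at this
    exact this.symm
  by_cases hT : j ∈ T
  · rw [Finset.piecewise_eq_of_mem _ _ _ hT, factorA]
    split_ifs
    · exact hg.smul_right _
    · exact Commute.zero_right _
    · exact hz
  · rw [Finset.piecewise_eq_of_notMem _ _ _ hT, factorB]
    split_ifs
    · exact Commute.zero_right _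
    · exact Commute.one_right _
    · exact bL_mul_bL hn hℓ hζ t 0 j

/-- Inserting i replaces the factors z_i and b_{i+1} by τ_i g_i and 1, while z_i b_{i+1} = -(t_i /
(ζ - 1)) g_i; this accounts for the sign. At the last index the two factors stand at opposite ends
in the order b_0, z_{n-1}, and restoring the order costs the extra ζ in `tau`. -/
theorem piecewise_prod_insert {S T : Finset (Fin n)} {i : Fin n} (hi : i ∉ S)
    (hST : insert i S ⊆ descents T) :
    (List.ofFn (T.piecewise (factorA hn hℓ hζ t (insert i S))
        (factorB hn hℓ hζ t (insert i S)))).prod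
      = - (List.ofFn (T.piecewise (factorA hn hℓ hζ t S) (factorB hn hℓ hζ t S))).prod := by
  set m := T.piecewise (factorA hn hℓ hζ t (insert i S)) (factorB hn hℓ hζ t (insert i S))
    with hm
  set m' := T.piecewise (factorA hn hℓ hζ t S) (factorB hn hℓ hζ t S) with hm'
  obtain ⟨hiT, hiT'⟩ := mem_descents.1 (hST (Finset.mem_insert_self i S))
  have hsub : ∀ k ∈ S, k ∈ T ∧ k + 1 ∉ T := fun k hk =>
    mem_descents.1 (hST (Finset.mem_insert_of_mem hk))
  have hpred : i - 1 ∉ S := fun h => (hsub _ h).2 (by simpa using hiT)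
  have hsucc : i + 1 ∉ S := fun h => hiT' (hsub _ h).1
  have hne := succ_ne hn i
  have m1 : m i = tau ζ t i • gL hn hℓ hζ (gen hn hℓ hζ i) := by
    rw [hm, Finset.piecewise_eq_of_mem _ _ _ hiT, factorA, if_pos (Finset.mem_insert_self i S)]
  have m2 : m (i + 1) = 1 := by
    rw [hm, Finset.piecewise_eq_of_notMem _ _ _ hiT', factorB, if_neg, if_pos]
    · simp
    · simp [hsucc, hne]
  have m3 : m' i = zL hn hℓ hζ i := by
    rw [hm', Finset.piecewise_eq_of_mem _ _ _ hiT, factorA, if_neg hi, if_neg hpred]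
  have m4 : m' (i + 1) = bL hn hℓ hζ t (i + 1) := by
    rw [hm', Finset.piecewise_eq_of_notMem _ _ _ hiT', factorB, if_neg hsucc,
      if_neg (by simpa using hi)]
  have moff : ∀ j, j ≠ i → j ≠ i + 1 → m j = m' j := by
    intro j h1 h2
    have h3 : j - 1 ≠ i := fun h => h2 (by rw [← h, sub_add_cancel])
    have e1 : j ∈ insert i S ↔ j ∈ S := by simp [h1]
    have e2 : j - 1 ∈ insert i S ↔ j - 1 ∈ S := by simp [h3]
    simp only [hm, hm', Finset.piecewise, factorA, factorB, e1, e2]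
  by_cases hlast : i.val = n - 1
  · have hz : i + 1 = 0 := by
      apply Fin.ext
      rw [Fin.val_add, Fin.val_one', Nat.mod_eq_of_lt (show 1 < n by omega), hlast,
        Nat.sub_add_cancel (by omega), Nat.mod_self, Fin.val_zero]
    have hi' : (⟨n - 1, by omega⟩ : Fin n) = i := Fin.ext hlast.symm
    obtain ⟨a, ha, h1, h2⟩ := ofFn_prod_ends (by omega) m' m (by
      intro j hj hj'
      refine (moff j (fun h => hj' (by rw [h, hlast])) ?_).symm
      rw [hz]
      exact fun h => hj (by simp [h]))
    have h0 : (⟨0, by omega⟩ : Fin n) = i + 1 := by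
      rw [hz]
      rfl
    rw [h0, hi', m3, m4, hz] at h1
    rw [h0, hi', m1, m2, one_mul] at h2
    have hcomm : Commute (bL hn hℓ hζ t 0) a :=
      ha _ fun j hj hj' => bL_zero_commute hn hℓ hζ t S T hj hj'
    have hgen : genEntry ζ (0 - 1) i = ζ := by
      rw [← hz]
      simp [genEntry]
    have hzb := zL_mul_bL_succ hn hℓ hζ t i
    rw [hz] at hzb
    -- b_0 moves past the interior factors a freely and past z_{n-1} with the factor ζ.
    rw [h1, h2, hcomm.eq, mul_assoc, bL_mul_zL, hgen, hzb, smul_smul, ← mul_neg, ← neg_smul]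
    congr 2
    rw [tau, if_pos hlast, sigma]
    ring
  · have hv : (i + 1).val = i.val + 1 := by
      rw [Fin.val_add, Fin.val_one', Nat.mod_eq_of_lt (show 1 < n by omega),
        Nat.mod_eq_of_lt (by omega)]
    have hlt : i.val + 1 < n := by omega
    have hi' : (⟨i.val + 1, hlt⟩ : Fin n) = i + 1 := Fin.ext hv.symm
    obtain ⟨a, b, h1, h2⟩ := ofFn_prod_consecutive m m' i.val hlt (by
      intro j hj hj'
      exact moff j (fun h => hj (by rw [h])) (fun h => hj' (by rw [h, hv])))
    rw [hi', Fin.eta, m1, m2, mul_one] at h1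
    rw [hi', Fin.eta, m3, m4, zL_mul_bL_succ] at h2
    rw [h1, h2, tau, if_neg hlast, neg_smul, mul_neg, neg_mul, neg_neg, sigma]

theorem piecewise_prod_of_subset {S T : Finset (Fin n)} (hST : S ⊆ descents T) :
    (List.ofFn (T.piecewise (factorA hn hℓ hζ t S) (factorB hn hℓ hζ t S))).prod
      = (-1 : ℤ) ^ S.card • (List.ofFn (T.piecewise (zL hn hℓ hζ) (bL hn hℓ hζ t))).prod := by
  induction S using Finset.induction_on with
  | empty =>
    rw [Finset.card_empty, pow_zero, one_smul]
    congr 2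
  | insert i S hi ih =>
    rw [piecewise_prod_insert hn hℓ hζ t hi hST, ih ((Finset.subset_insert i S).trans hST),
      Finset.card_insert_of_notMem hi, pow_succ, mul_neg_one, neg_smul]

theorem cyclic_induction {P : Fin n → Prop} {i : Fin n} (hi : P i) (succ : ∀ j, P j → P (j + 1))
    (j : Fin n) : P j := by
  have add : ∀ k : ℕ, P (i + Fin.ofNat n k) := by
    intro k
    induction k with
    | zero => simpa using hi
    | succ k ih =>
      have e : Fin.ofNat n (k + 1) = Fin.ofNat n k + 1 := by
        apply Fin.ext
        simp [Fin.val_add]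
      rw [e, ← add_assoc]
      exact succ _ ih
  simpa using add (j - i).val

/-- A subset closed under the cyclic successor is empty or everything. -/
theorem descents_eq_empty_iff {T : Finset (Fin n)} :
    descents T = ∅ ↔ T = ∅ ∨ T = Finset.univ := by
  constructor
  · intro h
    rw [or_iff_not_imp_left]
    intro hT
    obtain ⟨i, hi⟩ := Finset.nonempty_iff_ne_empty.2 hT
    have succ_mem : ∀ j ∈ T, j + 1 ∈ T := by
      intro j hj
      by_contra hj'
      have := mem_descents.2 ⟨hj, hj'⟩
      simp [h] at this
    rw [Finset.eq_univ_iff_forall]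
    exact cyclic_induction hi succ_mem
  · rintro (rfl | rfl)
    · rfl
    · ext j
      simp [mem_descents]

/-- Each summand, indexed by S, is an ordered product of sums `factorA` + `factorB`; expand it over
the set T of positions where `factorA` is chosen, and exchange the sums. For fixed T only S ⊆
`descents T` contribute, each giving (-1)^|S| times the same product. These signs sum to zero unless
T has no descents, which leaves T = univ (all z) and T = ∅ (all b). -/
theorem toTorus_w : toTorus hn hℓ hζ t (Hecke.w hn hℓ hζ t)
    = (List.ofFn (zL hn hℓ hζ)).prod + (List.ofFn (bL hn hℓ hζ t)).prod := by
  classical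
  rw [Hecke.w, map_sum]
  have h1 : ∀ S ∈ nonadjacentSets n, toTorus hn hℓ hζ t ((∏ i ∈ S, tau ζ t i) •
      (Hecke.xpow hn hℓ hζ t (delta n - ∑ i ∈ S, eps i) *
        ((S.sort (· ≤ ·)).map (Hecke.g hn hℓ hζ t)).prod))
      = ∑ T : Finset (Fin n),
        (List.ofFn (T.piecewise (factorA hn hℓ hζ t S) (factorB hn hℓ hζ t S))).prod := by
    intro S hS
    rw [toTorus_summand hn hℓ hζ t hS]
    have := MultilinearMap.map_add_univ (MultilinearMap.mkPiAlgebraFin ℂ n (Torus hn hℓ hζ))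
      (factorA hn hℓ hζ t S) (factorB hn hℓ hζ t S)
    simpa only [MultilinearMap.mkPiAlgebraFin_apply] using this
  rw [Finset.sum_congr rfl h1, Finset.sum_comm]
  have h2 : ∀ T ∈ (Finset.univ : Finset (Finset (Fin n))), ∑ S ∈ nonadjacentSets n,
      (List.ofFn (T.piecewise (factorA hn hℓ hζ t S) (factorB hn hℓ hζ t S))).prod
      = if T = ∅ ∨ T = Finset.univ then
        (List.ofFn (T.piecewise (zL hn hℓ hζ) (bL hn hℓ hζ t))).prod else 0 := by
    intro T _
    rw [← Finset.sum_subset (s₁ := (descents T).powerset)]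
    · rw [Finset.sum_congr rfl fun S hS =>
        piecewise_prod_of_subset hn hℓ hζ t (Finset.mem_powerset.1 hS), ← Finset.sum_smul,
        Finset.sum_powerset_neg_one_pow_card]
      simp only [descents_eq_empty_iff, ite_smul, one_smul, zero_smul]
    · intro S hS
      exact mem_nonadjacentSets_of_subset_descents (Finset.mem_powerset.1 hS)
    · intro S hS hS'
      exact piecewise_prod_eq_zero hn hℓ hζ t hS fun h => hS' (Finset.mem_powerset.2 h)
  have hne : (∅ : Finset (Fin n)) ≠ Finset.univ := by
    intro h
    have := Finset.mem_univ (0 : Fin n)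
    simp [← h] at this
  rw [Finset.sum_congr rfl h2, ← Finset.sum_filter]
  have h3 : (Finset.univ.filter fun T : Finset (Fin n) => T = ∅ ∨ T = Finset.univ)
      = {Finset.univ, ∅} := by
    ext T
    simp [or_comm]
  rw [h3, Finset.sum_pair hne.symm, Finset.piecewise_univ, Finset.piecewise_empty]

theorem toTorus_w_comm (f : Torus hn hℓ hζ) :
    f * toTorus hn hℓ hζ t (Hecke.w hn hℓ hζ t) = toTorus hn hℓ hζ t (Hecke.w hn hℓ hζ t) * f := by
  obtain ⟨e, he⟩ := bL_prod hn hℓ hζ t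
  rw [toTorus_w, he, zL_prod, mul_add, add_mul, mul_smul_comm, smul_mul_assoc, mono_const_comm,
    mono_const_comm]

theorem w_mem_center : Hecke.w hn hℓ hζ t ∈ Subalgebra.center ℂ (Hecke hn hℓ hζ t) := by
  rw [Subalgebra.mem_center_iff]
  intro b
  apply toTorus_injective hn hℓ hζ t
  rw [map_mul, map_mul, toTorus_w_comm]

end Central

section Center

variable {n ℓ : ℕ} [NeZero n] (hn : 3 ≤ n) (hℓ : 2 ≤ ℓ) {ζ : ℂ} (hζ : IsPrimitiveRoot ζ ℓ)
  (t : Fin n → ℂ)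

/-! ### The powers `x_i ^ ℓ` -/

/-- A q-analogue of the Leibniz rule: each passage of y past one factor x leaves a g, and carrying g
through the remaining factors produces the powers of q. -/
theorem mul_pow_of_commutator {A : Type*} [Ring A] [Algebra ℂ A] {x y g : A} {c q : ℂ}
    (hxy : y * x - x * y = c • g) (hg : g * x = q • (x * g)) (k : ℕ) :
    y * x ^ (k + 1) = x ^ (k + 1) * y + (c * ∑ m ∈ Finset.range (k + 1), q ^ m) • (x ^ k * g) := by
  have hyx : y * x = x * y + c • g := by rw [← hxy]; abel
  induction k with
  | zero => simp [hyx]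
  | succ k ih =>
    rw [pow_succ x (k + 1), ← mul_assoc, ih, add_mul, smul_mul_assoc, mul_assoc (x ^ k), hg,
      mul_assoc, hyx, mul_add, mul_smul_comm, mul_smul_comm, smul_smul, ← mul_assoc (x ^ k),
      ← pow_succ, ← mul_assoc, add_assoc, ← add_smul, geom_sum_succ (n := k + 1)]
    congr 2
    ring

theorem mul_pow_of_commutator_of_pow_eq_one {A : Type*} [Ring A] [Algebra ℂ A] {x y g : A}
    {c q : ℂ} (hxy : y * x - x * y = c • g) (hg : g * x = q • (x * g)) (hq : q ≠ 1) {k : ℕ}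
    (hqk : q ^ k = 1) : y * x ^ k = x ^ k * y := by
  cases k with
  | zero => simp
  | succ k =>
    have h := geom_sum_mul q (k + 1)
    rw [hqk, sub_self, mul_eq_zero, or_iff_left (sub_ne_zero.2 hq)] at h
    rw [mul_pow_of_commutator hxy hg, h, mul_zero, zero_smul, add_zero]

theorem xL_mul_xL_pow (i j : Fin n) :
    xL hn hℓ hζ t j * xL hn hℓ hζ t i ^ ℓ = xL hn hℓ hζ t i ^ ℓ * xL hn hℓ hζ t j := by
  have hne : ζ ≠ 1 := hζ.ne_one (by omega)
  by_cases hij : Adjacent i j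
  · rcases hij with rfl | rfl
    · refine mul_pow_of_commutator_of_pow_eq_one (c := - t i) (q := ζ)
        (g := gL hn hℓ hζ (gen hn hℓ hζ i)) ?_ ?_ hne hζ.pow_eq_one
      · rw [neg_smul, ← xL_commutator_succ, neg_sub]
      · rw [gL_mul_xL, entry_gen, genEntry, if_pos rfl]
    · refine mul_pow_of_commutator_of_pow_eq_one (c := t j) (q := ζ⁻¹)
        (g := gL hn hℓ hζ (gen hn hℓ hζ j)) (xL_commutator_succ hn hℓ hζ t j) ?_
        (inv_ne_one.2 hne) (by rw [inv_pow, hζ.pow_eq_one, inv_one])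
      rw [gL_mul_xL, entry_gen, genEntry, if_neg (succ_ne hn j), if_pos rfl]
  · have h : Commute (xL hn hℓ hζ t i) (xL hn hℓ hζ t j) :=
      sub_eq_zero.1 (xL_commutator_of_not_adjacent hn hℓ hζ t hij)
    exact (h.pow_left ℓ).eq.symm

theorem gL_mul_xL_pow (h : diagGroup n ℓ) (i : Fin n) (k : ℕ) :
    gL hn hℓ hζ h * xL hn hℓ hζ t i ^ k
      = (entry i h : ℂ) ^ k • (xL hn hℓ hζ t i ^ k * gL hn hℓ hζ h) := by
  induction k with
  | zero => simp
  | succ k ih =>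
    rw [pow_succ, ← mul_assoc, ih, smul_mul_assoc, mul_assoc, gL_mul_xL, mul_smul_comm, smul_smul,
      mul_assoc, pow_succ]

theorem x_pow_mem_center (i : Fin n) :
    Hecke.x hn hℓ hζ t i ^ ℓ ∈ Subalgebra.center ℂ (Hecke hn hℓ hζ t) := by
  refine Hecke.mem_center_of_commute hn hℓ hζ t (fun j => ?_) (fun h => ?_)
  · apply toTorus_injective hn hℓ hζ t
    simp only [map_mul, map_pow, toTorus_x, xL_mul_xL_pow]
  · apply toTorus_injective hn hℓ hζ t
    simp only [map_mul, map_pow, toTorus_x, toTorus_ofGroup, gL_mul_xL_pow]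
    rw [← Units.val_pow_eq_pow_val, entry_pow, Units.val_one, one_smul]

/-! ### Leading monomials -/

/-- The image of `y` has leading term `z^p`. -/
def HasLead (p : Fin n → ℤ) (y : Hecke hn hℓ hζ t) : Prop :=
  toTorus hn hℓ hζ t y - mono hn hℓ hζ p 1 ∈ degLT hn hℓ hζ (∑ j, p j)

variable {t}

theorem HasLead.mem_degLT {p : Fin n → ℤ} {y : Hecke hn hℓ hζ t} (hy : HasLead hn hℓ hζ t p y) :
    toTorus hn hℓ hζ t y ∈ degLT hn hℓ hζ (∑ j, p j + 1) := by
  rw [← sub_add_cancel (toTorus hn hℓ hζ t y) (mono hn hℓ hζ p 1)]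
  exact Submodule.add_mem _ (degLT_mono hn hℓ hζ (by omega) hy)
    (mono_mem_degLT hn hℓ hζ (by omega) 1)

theorem mono_mul_mono_one (p q : Fin n → ℤ) :
    mono hn hℓ hζ p 1 * mono hn hℓ hζ q 1 = mono hn hℓ hζ (p + q) 1 := by
  rw [mono_mul, alphaFun_one_left, weight_one, mul_one, Units.val_one, one_smul, one_mul]

theorem HasLead.x_mul {p : Fin n → ℤ} {y : Hecke hn hℓ hζ t} (hy : HasLead hn hℓ hζ t p y)
    (i : Fin n) : HasLead hn hℓ hζ t (Pi.single i 1 + p) (Hecke.x hn hℓ hζ t i * y) := by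
  have hsum : ∑ j, (Pi.single i 1 + p : Fin n → ℤ) j = 1 + ∑ j, p j := by
    simp only [Pi.add_apply, Finset.sum_add_distrib, sum_single_one]
  rw [HasLead, map_mul, toTorus_x, xL, ← mono_mul_mono_one, add_mul, add_sub_right_comm, hsum]
  change zL hn hℓ hζ i * _ - zL hn hℓ hζ i * _ + _ ∈ _
  rw [← mul_sub]
  refine Submodule.add_mem _ (mono_mul_mem_degLT hn hℓ hζ ?_ 1 hy) ?_
  · rw [sum_single_one]
  · exact degLT_mono hn hℓ hζ (by omega) (bL_mul_mem_degLT hn hℓ hζ t i hy.mem_degLT)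

theorem HasLead.x_pow_mul {p : Fin n → ℤ} {y : Hecke hn hℓ hζ t} (hy : HasLead hn hℓ hζ t p y)
    (i : Fin n) (k : ℕ) :
    HasLead hn hℓ hζ t (Pi.single i (k : ℤ) + p) (Hecke.x hn hℓ hζ t i ^ k * y) := by
  induction k with
  | zero => simpa using hy
  | succ k ih =>
    have h := ih.x_mul hn hℓ hζ i
    rwa [← mul_assoc, ← pow_succ', ← add_assoc, ← Pi.single_add, add_comm (1 : ℤ),
      ← Nat.cast_succ] at h

theorem HasLead.w_mul {p : Fin n → ℤ} {y : Hecke hn hℓ hζ t} (hy : HasLead hn hℓ hζ t p y) :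
    HasLead hn hℓ hζ t ((fun _ => 1) + p) (Hecke.w hn hℓ hζ t * y) := by
  obtain ⟨e, he⟩ := bL_prod hn hℓ hζ t
  have hsum : ∑ j, ((fun _ => 1) + p : Fin n → ℤ) j = n + ∑ j, p j := by
    simp [Finset.sum_add_distrib]
  rw [HasLead, map_mul, toTorus_w, zL_prod, he, ← mono_mul_mono_one, add_mul, add_sub_right_comm,
    ← mul_sub, hsum]
  refine Submodule.add_mem _ (mono_mul_mem_degLT hn hℓ hζ ?_ 1 hy) ?_
  · simp
  -- The product of the b_i has degree -n, so it cannot affect the leading term.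
  · rw [smul_mul_assoc]
    refine Submodule.smul_mem _ _ (mono_mul_mem_degLT hn hℓ hζ ?_ 1 hy.mem_degLT)
    simp
    omega

/-! ### The subalgebra generated by the `x_i ^ ℓ` and `w`, and its leading monomials. -/

variable (t)

/-- The subalgebra generated by the `x_i ^ ℓ` and `w`. -/
def centralSubalgebra : Subalgebra ℂ (Hecke hn hℓ hζ t) :=
  Algebra.adjoin ℂ (Set.range (fun i : Fin n => Hecke.x hn hℓ hζ t i ^ ℓ) ∪ {Hecke.w hn hℓ hζ t})

theorem x_pow_mem_centralSubalgebra (i : Fin n) :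
    Hecke.x hn hℓ hζ t i ^ ℓ ∈ centralSubalgebra hn hℓ hζ t :=
  Algebra.subset_adjoin (Or.inl ⟨i, rfl⟩)

theorem w_mem_centralSubalgebra : Hecke.w hn hℓ hζ t ∈ centralSubalgebra hn hℓ hζ t :=
  Algebra.subset_adjoin (Or.inr rfl)

theorem centralSubalgebra_le_center :
    centralSubalgebra hn hℓ hζ t ≤ Subalgebra.center ℂ (Hecke hn hℓ hζ t) := by
  rw [centralSubalgebra, Algebra.adjoin_le_iff]
  rintro _ (⟨i, rfl⟩ | rfl)
  · exact x_pow_mem_center hn hℓ hζ t i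
  · exact w_mem_center hn hℓ hζ t

/-- The witness is a product of the (x_i ^ ℓ) ^ q_i times w ^ k, each w contributing the exponent
(1, …, 1). -/
theorem exists_hasLead (q : Fin n → ℕ) (k : ℕ) : ∃ y ∈ centralSubalgebra hn hℓ hζ t,
    HasLead hn hℓ hζ t (fun j => ℓ * q j + k) y := by
  have h0 : ∃ y ∈ centralSubalgebra hn hℓ hζ t, HasLead hn hℓ hζ t (fun _ => (k : ℤ)) y := by
    induction k with
    | zero =>
      refine ⟨1, one_mem _, ?_⟩
      rw [HasLead, map_one]
      convert Submodule.zero_mem _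
      exact sub_self _
    | succ k ih =>
      obtain ⟨y, hy, hl⟩ := ih
      refine ⟨_, mul_mem (w_mem_centralSubalgebra hn hℓ hζ t) hy, ?_⟩
      convert hl.w_mul hn hℓ hζ using 1
      ext j
      simp [add_comm]
  have h1 : ∀ (m : ℕ) (i : Fin n) (p : Fin n → ℤ),
      (∃ y ∈ centralSubalgebra hn hℓ hζ t, HasLead hn hℓ hζ t p y) →
      ∃ y ∈ centralSubalgebra hn hℓ hζ t,
        HasLead hn hℓ hζ t (Pi.single i (ℓ * m : ℤ) + p) y := by
    intro m i p hp
    induction m with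
    | zero => simpa using hp
    | succ m ih =>
      obtain ⟨y, hy, hl⟩ := ih
      refine ⟨_, mul_mem (x_pow_mem_centralSubalgebra hn hℓ hζ t i) hy, ?_⟩
      convert hl.x_pow_mul hn hℓ hζ i ℓ using 1
      rw [← add_assoc, ← Pi.single_add]
      push_cast
      congr 2
      ring
  have h2 : ∀ F : Finset (Fin n), ∃ y ∈ centralSubalgebra hn hℓ hζ t,
      HasLead hn hℓ hζ t (∑ i ∈ F, Pi.single i (ℓ * q i : ℤ) + fun _ => (k : ℤ)) y := by
    intro F
    induction F using Finset.induction_on with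
    | empty => simpa using h0
    | insert i F hi ih =>
      have := h1 (q i) i _ ih
      rwa [← add_assoc, ← Finset.sum_insert hi (f := fun i => Pi.single i (ℓ * q i : ℤ))] at this
  convert h2 Finset.univ using 4 with y
  ext j
  simp [Finset.sum_apply, Pi.single_apply]

/-! ### Leading terms of central elements -/

theorem weight_gen (p : Fin n → ℤ) (i : Fin n) :
    (weight p (gen hn hℓ hζ i) : ℂ) = ζ ^ (p i - p (i + 1)) := by
  have hζ0 : ζ ≠ 0 := hζ.ne_zero (by omega)
  rw [weight, Units.coe_prod]
  have hite : ∀ (P : Prop) [Decidable P] (a : ℂ) (k : ℤ),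
      (if P then a else 1) ^ k = if P then a ^ k else 1 := by
    intro P _ a k
    split_ifs <;> simp
  simp only [Units.val_zpow_eq_zpow_val, entry_gen, genEntry_eq hn, mul_zpow, hite,
    Finset.prod_mul_distrib, Finset.prod_ite_eq', Finset.mem_univ, if_true]
  rw [sub_eq_add_neg, zpow_add₀ hζ0, inv_zpow, zpow_neg]

variable {t}

/-- Compare the coefficients of z_i z^p g in x_i y = y x_i. The terms with b_i have too small a
degree, and on the right z_i has to pass g. -/
theorem entry_mul_coeff {d : ℕ} {y : Hecke hn hℓ hζ t}
    (hy : y ∈ Subalgebra.center ℂ (Hecke hn hℓ hζ t))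
    (hd : toTorus hn hℓ hζ t y ∈ degLT hn hℓ hζ (d + 1)) {p : Fin n → ℤ} (hp : ∑ j, p j = d)
    (g : diagGroup n ℓ) (i : Fin n) :
    coeff hn hℓ hζ p g (toTorus hn hℓ hζ t y)
      = entry i g * coeff hn hℓ hζ p g (toTorus hn hℓ hζ t y) := by
  have hcomm := congrArg (toTorus hn hℓ hζ t)
    (Subalgebra.mem_center_iff.1 hy (Hecke.x hn hℓ hζ t i))
  rw [map_mul, map_mul, toTorus_x, xL, add_mul, mul_add] at hcomm
  set f := toTorus hn hℓ hζ t y with hf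
  have hsum : ∑ j, (Pi.single i 1 + p : Fin n → ℤ) j = 1 + d := by
    simp only [Pi.add_apply, Finset.sum_add_distrib, sum_single_one, hp]
  have hl := (HomocyclicHecke.mem_degLT hn hℓ hζ).1 (bL_mul_mem_degLT hn hℓ hζ t i hd)
    (Pi.single i 1 + p) g (by omega)
  have hr := (HomocyclicHecke.mem_degLT hn hℓ hζ).1 (mul_bL_mem_degLT hn hℓ hζ t i hd)
    (Pi.single i 1 + p) g (by omega)
  have hc := congrArg (coeff hn hℓ hζ (Pi.single i 1 + p) g) hcomm
  rw [map_add, map_add, hl, hr, add_zero, add_zero] at hc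
  have e1 := coeff_mono_mul hn hℓ hζ (Pi.single i 1) p 1 g f
  have e2 := coeff_mul_mono hn hℓ hζ p (Pi.single i 1) g 1 f
  rw [one_mul, alphaFun_one_left, weight_one, mul_one, Units.val_one, one_mul] at e1
  rw [mul_one, alphaFun_one_right, weight_single, one_mul, add_comm] at e2
  exact e1.symm.trans (hc.trans e2)

/-- Compare the coefficients of z^p g in g y = y g: on the left, g has to pass z^p. No degree bound
is needed, since g maps to a single monomial. -/
theorem weight_mul_coeff {y : Hecke hn hℓ hζ t}
    (hy : y ∈ Subalgebra.center ℂ (Hecke hn hℓ hζ t)) (p : Fin n → ℤ) (g : diagGroup n ℓ) :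
    weight p g * coeff hn hℓ hζ p 1 (toTorus hn hℓ hζ t y)
      = coeff hn hℓ hζ p 1 (toTorus hn hℓ hζ t y) := by
  have hcomm := congrArg (toTorus hn hℓ hζ t)
    (Subalgebra.mem_center_iff.1 hy (Hecke.ofGroup hn hℓ hζ t g))
  rw [map_mul, map_mul, toTorus_ofGroup] at hcomm
  have e1 := coeff_mono_mul hn hℓ hζ 0 p g 1 (toTorus hn hℓ hζ t y)
  have e2 := coeff_mul_mono hn hℓ hζ p 0 1 g (toTorus hn hℓ hζ t y)
  rw [mul_one, zero_add, alphaFun_one_right, one_mul] at e1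
  rw [one_mul, add_zero, alphaFun_one_left, weight_zero, one_mul, Units.val_one, one_mul] at e2
  exact e1.symm.trans ((congrArg (coeff hn hℓ hζ p g) hcomm).trans e2)

theorem eq_one_of_coeff_ne_zero {d : ℕ} {y : Hecke hn hℓ hζ t}
    (hy : y ∈ Subalgebra.center ℂ (Hecke hn hℓ hζ t))
    (hd : toTorus hn hℓ hζ t y ∈ degLT hn hℓ hζ (d + 1)) {p : Fin n → ℤ} (hp : ∑ j, p j = d)
    {g : diagGroup n ℓ} (hc : coeff hn hℓ hζ p g (toTorus hn hℓ hζ t y) ≠ 0) : g = 1 := by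
  refine eq_of_entry_eq fun i => Units.ext ?_
  rw [map_one, Units.val_one]
  exact mul_right_cancel₀ hc ((entry_mul_coeff hn hℓ hζ hy hd hp g i).symm.trans (one_mul _).symm)

theorem exists_hasLead_of_coeff_ne_zero {y : Hecke hn hℓ hζ t}
    (hy : y ∈ Subalgebra.center ℂ (Hecke hn hℓ hζ t)) {p : Fin n → ℕ}
    (hc : coeff hn hℓ hζ (fun j => (p j : ℤ)) 1 (toTorus hn hℓ hζ t y) ≠ 0) :
    ∃ s ∈ centralSubalgebra hn hℓ hζ t, HasLead hn hℓ hζ t (fun j => (p j : ℤ)) s := by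
  -- Invariance of z^p under g_i gives ζ ^ (p i - p (i + 1)) = 1, so neighbouring exponents agree
  -- modulo ℓ. Their common remainder becomes the power of w and the quotients become the powers of
  -- the x_i ^ ℓ.
  have hmod : ∀ i, p i % ℓ = p 0 % ℓ := by
    refine cyclic_induction (i := 0) rfl fun i hi => ?_
    have h := weight_mul_coeff hn hℓ hζ hy (fun j => (p j : ℤ)) (gen hn hℓ hζ i)
    rw [weight_gen] at h
    have h1 := mul_right_cancel₀ hc (h.trans (one_mul _).symm)
    rw [hζ.zpow_eq_one_iff_dvd] at h1
    rw [← hi]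
    exact (Nat.modEq_iff_dvd.2 h1 : p (i + 1) ≡ p i [MOD ℓ])
  obtain ⟨s, hs, hl⟩ := exists_hasLead hn hℓ hζ t (fun j => p j / ℓ) (p 0 % ℓ)
  refine ⟨s, hs, ?_⟩
  convert hl using 2 with j
  rw [← hmod j]
  exact_mod_cast (Nat.div_add_mod (p j) ℓ).symm

theorem mem_centralSubalgebra_of_mem_degLT (d : ℕ) : ∀ y : Hecke hn hℓ hζ t,
    y ∈ Subalgebra.center ℂ (Hecke hn hℓ hζ t) →
    toTorus hn hℓ hζ t y ∈ degLT hn hℓ hζ d → y ∈ centralSubalgebra hn hℓ hζ t := by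
  classical
  induction d with
  | zero =>
    intro y _ hd
    have := mem_filt_of_toTorus_mem_degLT hn hℓ hζ t hd
    rw [Hecke.filt_zero, Submodule.mem_bot] at this
    rw [this]
    exact zero_mem _
  | succ d ih =>
    intro y hy hd
    have hfilt := mem_filt_of_toTorus_mem_degLT hn hℓ hζ t hd
    rw [Nat.cast_succ] at hd
    set c : (Fin n → ℕ) → ℂ :=
      fun p => coeff hn hℓ hζ (fun j => (p j : ℤ)) 1 (toTorus hn hℓ hζ t y) with hcdef
    -- Stating the leading term as an implication allows a choice for every p, with 0 where the
    -- coefficient vanishes.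
    have hs : ∀ p : Fin n → ℕ, ∃ s ∈ centralSubalgebra hn hℓ hζ t,
        c p ≠ 0 → HasLead hn hℓ hζ t (fun j => (p j : ℤ)) s := by
      intro p
      by_cases hc : c p = 0
      · exact ⟨0, zero_mem _, fun h => absurd hc h⟩
      · obtain ⟨s, hs, hl⟩ := exists_hasLead_of_coeff_ne_zero hn hℓ hζ hy hc
        exact ⟨s, hs, fun _ => hl⟩
    choose s hsA hsl using hs
    have hsumA : ∑ p ∈ Finset.piAntidiag Finset.univ d, c p • s p
        ∈ centralSubalgebra hn hℓ hζ t :=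
      sum_mem fun p _ => Subalgebra.smul_mem _ (hsA p) _
    have htop : toTorus hn hℓ hζ t y - ∑ p ∈ Finset.piAntidiag Finset.univ d,
        c p • mono hn hℓ hζ (fun j => (p j : ℤ)) 1 ∈ degLT hn hℓ hζ d := by
      rw [HomocyclicHecke.mem_degLT]
      intro r g hr
      rw [map_sub, map_sum, sub_eq_zero]
      simp only [map_smul, coeff_mono, smul_eq_mul]
      by_cases hcr : coeff hn hℓ hζ r g (toTorus hn hℓ hζ t y) = 0
      · rw [hcr, Finset.sum_eq_zero]
        intro p _
        by_cases h : (fun j => (p j : ℤ)) = r ∧ 1 = g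
        · obtain ⟨rfl, rfl⟩ := h
          rw [hcdef]
          simp [hcr]
        · rw [if_neg h, mul_zero]
      · have hrd : ∑ j, r j = d := by
          by_contra hne
          exact hcr ((HomocyclicHecke.mem_degLT hn hℓ hζ).1 hd r g (by omega))
        obtain rfl := eq_one_of_coeff_ne_zero hn hℓ hζ hy hd hrd hcr
        -- The sum runs over natural exponents only, so negative exponents must be excluded in top
        -- degree; this uses that y lies in the filtration, not merely the degree of its image.
        have hnn := exists_nat_exponent hn hℓ hζ t hfilt hrd hcr
        obtain ⟨p, rfl⟩ : ∃ p : Fin n → ℕ, r = fun j => (p j : ℤ) :=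
          ⟨fun j => (r j).toNat, funext fun j => (Int.toNat_of_nonneg (hnn j)).symm⟩
        rw [Finset.sum_eq_single p]
        · simp [hcdef]
        · intro q _ hq
          rw [if_neg, mul_zero]
          rintro ⟨h, -⟩
          exact hq (funext fun j => by exact_mod_cast congrFun h j)
        · intro h
          have hpd : ∑ j, p j = d := by
            simp only [← Nat.cast_sum] at hrd
            exact_mod_cast hrd
          exact absurd (Finset.mem_piAntidiag.2 ⟨hpd, by simp⟩) h
    -- The difference is still central because the subtracted elements are. Its image is the image
    -- of y without its leading monomials, minus the lower-degree errors of the chosen s p.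
    have hy' := ih (y - ∑ p ∈ Finset.piAntidiag Finset.univ d, c p • s p)
      (sub_mem hy (centralSubalgebra_le_center hn hℓ hζ t hsumA)) (by
        have hsub : toTorus hn hℓ hζ t (y - ∑ p ∈ Finset.piAntidiag Finset.univ d, c p • s p)
            = (toTorus hn hℓ hζ t y - ∑ p ∈ Finset.piAntidiag Finset.univ d,
                c p • mono hn hℓ hζ (fun j => (p j : ℤ)) 1)
              - ∑ p ∈ Finset.piAntidiag Finset.univ d,
                c p • (toTorus hn hℓ hζ t (s p) - mono hn hℓ hζ (fun j => (p j : ℤ)) 1) := by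
          simp only [map_sub, map_sum, map_smul, smul_sub, Finset.sum_sub_distrib]
          abel
        rw [hsub]
        refine sub_mem htop (sum_mem fun p hp => ?_)
        by_cases hc : c p = 0
        · rw [hc, zero_smul]
          exact zero_mem _
        · refine Submodule.smul_mem _ _ ?_
          have := hsl p hc
          rwa [HasLead, ← Nat.cast_sum, (Finset.mem_piAntidiag.1 hp).1] at this)
    rw [← sub_add_cancel y (∑ p ∈ Finset.piAntidiag Finset.univ d, c p • s p)]
    exact add_mem hy' hsumA

end Center

end HomocyclicHecke

end

theorem theorem2 (n ℓ : ℕ) [NeZero n] (hn : 3 ≤ n) (hℓ : 2 ≤ ℓ) (ζ : ℂ)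
    (hζ : IsPrimitiveRoot ζ ℓ) (t : Fin n → ℂ) :
    Subalgebra.center ℂ (HomocyclicHecke.Hecke hn hℓ hζ t) =
      Algebra.adjoin ℂ
        (Set.range (fun i : Fin n => HomocyclicHecke.Hecke.x hn hℓ hζ t i ^ ℓ) ∪
          {HomocyclicHecke.Hecke.w hn hℓ hζ t}) := by
  refine le_antisymm (fun y hy => ?_) (HomocyclicHecke.centralSubalgebra_le_center hn hℓ hζ t)
  obtain ⟨d, hd⟩ := HomocyclicHecke.Hecke.exists_mem_filt hn hℓ hζ t y
  exact HomocyclicHecke.mem_centralSubalgebra_of_mem_degLT hn hℓ hζ d y hy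
    (HomocyclicHecke.toTorus_mem_degLT hn hℓ hζ t hd)
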